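/- Let $k$ be a positive integer and let $\alpha$ be the positive root of $sl_2$, $\langle\alpha,\alpha\rangle=2$. Let $\Phi=\bigoplus_{\lambda\in\mathbb Z/k}\Phi_\lambda$ be a space of $sl_2$-parafermions at level $-k$: a complex vector space graded by the charge lattice $\mathbb Z\alpha$ modulo $k\mathbb Z\alpha$, with two formal fields $A_\alpha(z)$, $A^*_{-\alpha}(z)$ (series in rational powers of $z$, truncated from below on each vector) such that - $A_\alpha(z)$ maps $\Phi_n$ to $\Phi_{n+1}$ and involves on $\Phi_n$ only powers $z^r$, $r\in \frac{2n}{k}+\mathbb Z$; $A^*_{-\alpha}(z)$ maps $\Phi_n$ to $\Phi_{n-1}$ and involves on $\Phi_n$ only powers $z^r$, $r\in-\frac{2n}{k}+\mathbb Z$; - $A_\alpha(z)A_\alpha(w)(z-w)^{-2/k}$ and $A^*_{-\alpha}(z)A^*_{-\alpha}(w)(z-w)^{-2/k}$ are symmetric in $z,w$ (and hence have no singular part at $z=w$); - $A_\alpha(z)A^*_{-\alpha}(w)(z-w)^{2/k}=N(z,w)-\frac{kzw}{(z-w)^2}$ and $A^*_{-\alpha}(w)A_\alpha(z)(w-z)^{2/k}=N(z,w)-\frac{kzw}{(w-z)^2}$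 with one and the same $N$, regular at $z=w$. Precisely: $F(z,w)=A_\alpha(z)A^*_{-\alpha}(w)(z-w)^{2+2/k}$ equals $A^*_{-\alpha}(w)A_\alpha(z)(w-z)^{2+2/k}$, and $F(z,w)+kzw$ vanishes to second order on $z=w$. (In each product the power of $z-w$, resp. $w-z$, is expanded in nonnegative powers of the variable of the right-hand field.) Let $H(n)$, $n\ne0$, act on $S=\mathbb C[H(-1),H(-2),\dots]$ at level $-k$, i.e. $H(-n)$ by multiplication and $H(n)$ by $-2nk\,\partial/\partial H(-n)$ for $n>0$. On the group algebra $\mathbb C(\mathbb Z\alpha)$ let $H(0)e^{n\alpha}=2n\,e^{n\alpha}$ and $z^{s\alpha}e^{n\alpha}=z^{2sn}e^{n\alpha}$. Put $$E^\pm_+(z)=\exp\Big(\mp\sum_{n>0}\tfrac{H(-n)}{kn}z^n\Big),\qquad E^\pm_-(z)=\exp\Big(\pm\sum_{n>0}\tfrac{H(n)}{kn}z^{-n}\Big),$$ let $V=S\otimes\Phi\otimes\mathbb C(\mathbb Z\alpha)$, where $\Phi\otimes\mathbb C(\mathbb Z\alpha)$ stands for its part with matching charges, spanned by the $\varphi\otimes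 e^{n\alpha}$ with $\varphi\in\Phi_{n\bmod k}$, and let $$X(z)=E^+_+(z)E^+_-(z)\otimes A_\alpha(z)e^\alpha z^{-\alpha/k},\qquad Y(z)=E^-_+(z)E^-_-(z)\otimes A^*_{-\alpha}(z)e^{-\alpha}z^{\alpha/k},$$ $$Z^+(z)=E^-_+(z)X(z)E^-_-(z),\qquad Z^-(z)=E^+_+(z)Y(z)E^+_-(z).$$ Let $\Omega(V)=\{v\in V: H(n)v=0\text{ for all }n>0\}$ be the vacuum space. **Theorem.** All these products of formal series exist, $\Omega(V)=1\otimes\Phi\otimes\mathbb C(\mathbb Z\alpha)$ (matching charges), and on $\Omega(V)$ $$Z^+(z)=A_\alpha(z)e^\alpha z^{-\alpha/k},\qquad Z^-(z)=A^*_{-\alpha}(z)e^{-\alpha}z^{\alpha/k},$$ with integral powers of $z$ only. This gives a representation of the $Z$-algebra at level $-k$ on $\Omega(V)$: the coefficients of $Z^\pm(z)=\sum_{n\in\mathbb Z}Z^\pm(n)z^{-n}$ and $H(0)$ preserve $\Omega(V)$; on each vector $Z^\pm(n)$ vanishes for large $n$; $[H(0),Z^\pm(z)]=\pm2Z^\pm(z)$;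 and the generalized commutator relations hold: $$[\![Z^\pm(z),Z^\pm(w)]\!]=0,\qquad [\![Z^+(z),Z^-(w)]\!]=H(0)\,\delta(w/z)-k\,w\partial_w\delta(w/z).$$ Here $\delta(w/z)=\sum_{n\in\mathbb Z}(w/z)^n$ and, for $\phi_1,\phi_2\in\{\alpha,-\alpha\}$ with $Z(\pm\alpha,z)=Z^\pm(z)$, $$[\![Z(\phi_1,z),Z(\phi_2,w)]\!]=Z(\phi_1,z)Z(\phi_2,w)\big(1-\tfrac wz\big)^{-\langle\phi_1,\phi_2\rangle/k}-Z(\phi_2,w)Z(\phi_1,z)\big(1-\tfrac zw\big)^{-\langle\phi_1,\phi_2\rangle/k}.$$ -/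

import Mathlib

open scoped TensorProduct

noncomputable section

namespace Zalg

/-! ### Formal series with rational exponents -/

/-- A formal operator-valued series `F(z) = ∑ F r z^r` in rational powers of `z`;
`F r` is the coefficient of `z^r`. -/
abbrev Field (W : Type*) [AddCommGroup W] [Module ℂ W] : Type _ := ℚ → Module.End ℂ W

section Series

variable {W : Type*} [AddCommGroup W] [Module ℂ W]

/-- The product `F(z)G(z)` is well defined: on each vector, every coefficient
`∑ F a G (r - a)` is a finite sum. -/
def ProdDefined (F G : Field W) : Prop :=
  ∀ (r : ℚ) (v : W), (Function.support fun a : ℚ => F a (G (r - a) v)).Finite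

open Classical in
/-- The product `F(z)G(z)` of two formal series in the same variable. The value `0` is a
placeholder, used only where the product does not exist. -/
def prod (F G : Field W) : Field W := fun r =>
  if h : ProdDefined F G then
    { toFun := fun v => ∑ᶠ a : ℚ, F a (G (r - a) v)
      map_add' := by
        intro v w
        simp only [map_add]
        exact finsum_add_distrib (h r v) (h r w)
      map_smul' := by
        intro c v
        simp only [map_smul, RingHom.id_apply]
        exact (smul_finsum c _).symm }
  else 0

/-- `F(z)` is truncated: on each vector only finitely many negative powers of `z` matter. -/
def Truncated (F : Field W) : Prop := ∀ v : W, ∃ B : ℚ, ∀ r : ℚ, r < B → F r v = 0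

/-- The coefficient of `x^j` in the binomial series `(1 - x)^c`. -/
def binom (c : ℂ) (j : ℕ) : ℂ := (-1) ^ j * Ring.choose c j

/-- The coefficient of `z^a w^b` in `(z - w)^c F(z) G(w) v`, where
`(z - w)^c = z^c (1 - w/z)^c` is expanded in nonnegative powers of `w`. -/
def ope (c : ℚ) (F G : Field W) (v : W) (a b : ℚ) : W :=
  ∑ᶠ j : ℕ, binom (c : ℂ) j • F (a - c + j) (G (b - j) v)

/-- A series `f(z,w) = ∑ f a b z^a w^b` vanishes to second order on the diagonal `z = w`:
both `f` and `z ∂_z f` vanish at `z = w`. (Used only for series whose restriction to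
`z = w` is given by finite sums.) -/
def VanishesTwice (f : ℚ → ℚ → W) : Prop :=
  ∀ c : ℚ, (∑ᶠ a : ℚ, f a (c - a)) = 0 ∧ (∑ᶠ a : ℚ, (a : ℂ) • f a (c - a)) = 0

end Series

/-! ### Parafermions -/

/-- A space of `sl₂`-parafermions at level `-k`: a complex space `Φ` graded by the charge lattice
`M = ℤα` modulo `kM` (the class of `n` stands for the charge `nα`), with the fields
`A(z) = A_α(z)` and `A'(z) = A^*_{-α}(z)`, such that

* `A(z)` (resp. `A'(z)`) raises (resp. lowers) the charge by `α`, and on charge `nα` involves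
  only the powers `z^r` with `r ∈ 2n/k + ℤ` (resp. `r ∈ -2n/k + ℤ`);
* `A(z)A(w)(z-w)^{-2/k}` and `A'(z)A'(w)(z-w)^{-2/k}` have no singular part and are symmetric;
* `A(z)A'(w)(z-w)^{2/k} = N(z,w) - kzw/(z-w)²` and
  `A'(w)A(z)(w-z)^{2/k} = N(z,w) - kzw/(w-z)²` with the same `N(z,w)`, regular at `z = w`.

The operator products are multivalued, so the last item is read after multiplication
by `(z-w)²`: the two sides `(z-w)^{2+2/k}A(z)A'(w)` and `(w-z)^{2+2/k}A'(w)A(z)` are one and the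
same series, and this series plus `kzw` (which is `(z-w)² N(z,w)`) vanishes to second order
on `z = w`. -/
structure Parafermion (k : ℕ) (Φ : Type*) [AddCommGroup Φ] [Module ℂ Φ] where
  charge : ZMod k → Submodule ℂ Φ
  isInternal : DirectSum.IsInternal charge
  A : Field Φ
  A' : Field Φ
  A_truncated : Truncated A
  A'_truncated : Truncated A'
  A_charge : ∀ (l : ZMod k) (r : ℚ), ∀ v ∈ charge l, A r v ∈ charge (l + 1)
  A'_charge : ∀ (l : ZMod k) (r : ℚ), ∀ v ∈ charge l, A' r v ∈ charge (l - 1)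
  A_exponent : ∀ (n : ℤ) (r : ℚ), ∀ v ∈ charge (n : ZMod k),
    A r v ≠ 0 → ∃ m : ℤ, r = 2 * n / k + m
  A'_exponent : ∀ (n : ℤ) (r : ℚ), ∀ v ∈ charge (n : ZMod k),
    A' r v ≠ 0 → ∃ m : ℤ, r = -(2 * n / k) + m
  A_A : ∀ (v : Φ) (a b : ℚ), ope (-2 / k) A A v a b = ope (-2 / k) A A v b a
  A'_A' : ∀ (v : Φ) (a b : ℚ), ope (-2 / k) A' A' v a b = ope (-2 / k) A' A' v b a
  A_A'_local : ∀ (v : Φ) (a b : ℚ),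
    ope (2 + 2 / k) A A' v a b = ope (2 + 2 / k) A' A v b a
  A_A'_singular : ∀ v : Φ, VanishesTwice fun a b =>
    ope (2 + 2 / k) A A' v a b + if a = 1 ∧ b = 1 then (k : ℂ) • v else 0

/-! ### The Fock space of the Heisenberg algebra -/

/-- The symmetric algebra of `⊕_{n>0} ℂ H(-n)`; the variable `n` stands for `H(-n)`. -/
abbrev Fock : Type := MvPolynomial ℕ+ ℂ

/-- For `n > 0`, the operator `H(-n)` on the Fock space: multiplication. -/
def creation (n : ℕ+) : Module.End ℂ Fock := LinearMap.mulLeft ℂ (MvPolynomial.X n)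

/-- For `n > 0`, the operator `H(n)` at level `-k` on the Fock space: `-2nk ∂/∂H(-n)`. -/
def annihilation (k : ℕ) (n : ℕ+) : Module.End ℂ Fock :=
  (-(2 * (n : ℂ) * k)) • (MvPolynomial.pderiv n).toLinearMap

/-- The exponential of a power series `f` without constant term (its coefficient of degree `n`
only involves the powers `f^j` with `j ≤ n`). -/
def expSeries {R : Type*} [Ring R] [Algebra ℂ R] (f : PowerSeries R) : PowerSeries R :=
  PowerSeries.mk fun n =>
    ∑ j ∈ Finset.range (n + 1), ((j.factorial : ℂ)⁻¹) • PowerSeries.coeff n (f ^ j)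

/-- `∑_{n>0} H(-n)/(kn) t^n`. -/
def creationSeries (k : ℕ) : PowerSeries (Module.End ℂ Fock) :=
  PowerSeries.mk fun n =>
    if h : 0 < n then ((k : ℂ) * n)⁻¹ • creation ⟨n, h⟩ else 0

/-- `∑_{n>0} H(n)/(kn) t^n`. -/
def annihilationSeries (k : ℕ) : PowerSeries (Module.End ℂ Fock) :=
  PowerSeries.mk fun n =>
    if h : 0 < n then ((k : ℂ) * n)⁻¹ • annihilation k ⟨n, h⟩ else 0

/-- The power series `f(t)` at `t = z`, as a formal series in `z`. -/
def atZ {W : Type*} [AddCommGroup W] [Module ℂ W] (f : PowerSeries (Module.End ℂ W)) : Field W :=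
  fun r => if r.den = 1 ∧ 0 ≤ r then PowerSeries.coeff r.num.toNat f else 0

/-- The power series `f(t)` at `t = z⁻¹`, as a formal series in `z`. -/
def atZinv {W : Type*} [AddCommGroup W] [Module ℂ W] (f : PowerSeries (Module.End ℂ W)) :
    Field W :=
  fun r => atZ f (-r)

/-- `E^{±}_+(z) = exp(∓ ∑_{n>0} H(-n)/(kn) z^n)`, where `s = ±1` is the upper sign. -/
def fockEplus (k : ℕ) (s : ℂ) : Field Fock := atZ (expSeries ((-s) • creationSeries k))

/-- `E^{±}_-(z) = exp(± ∑_{n>0} H(n)/(kn) z^{-n})`, where `s = ±1` is the upper sign. -/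
def fockEminus (k : ℕ) (s : ℂ) : Field Fock := atZinv (expSeries (s • annihilationSeries k))

/-! ### The group algebra of `ℤα`, where `⟨α, α⟩ = 2` -/

/-- The group algebra `ℂ(ℤα)`; `e^{nα}` is the basis vector of `n`. -/
abbrev GroupAlg : Type := AddMonoidAlgebra ℂ ℤ

/-- The element `e^{nα}`. -/
def e (n : ℤ) : GroupAlg := AddMonoidAlgebra.single n 1

/-- Multiplication by `e^{nα}`. -/
def eMul (n : ℤ) : Module.End ℂ GroupAlg := LinearMap.mulLeft ℂ (e n)

/-- `α(0)`, with `α(0) e^{nα} = ⟨α, nα⟩ e^{nα} = 2n e^{nα}`. -/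
def alphaZero : Module.End ℂ GroupAlg :=
  (AddMonoidAlgebra.basis ℤ ℂ).constr ℂ fun n => (2 * (n : ℂ)) • e n

/-- The formal series `z^{sα}`, with `z^{sα} e^{nα} = z^{2sn} e^{nα}`. -/
def zPow (s : ℚ) : Field GroupAlg := fun r =>
  (AddMonoidAlgebra.basis ℤ ℂ).constr ℂ fun n => if r = 2 * s * n then e n else 0

/-! ### The module `V` and its vacuum space -/

section Module

variable {k : ℕ} {Φ : Type*} [AddCommGroup Φ] [Module ℂ Φ] (P : Parafermion k Φ)

/-- The full tensor product `S(𝔥'⁻) ⊗ Φ ⊗ ℂ(ℤα)`, on which all the operators are defined. -/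
abbrev Tens (Φ : Type*) [AddCommGroup Φ] [Module ℂ Φ] : Type _ := Fock ⊗[ℂ] (Φ ⊗[ℂ] GroupAlg)

/-- The space `Φ ⊗ ℂ(ℤα)` with matching charges: the span of the `φ ⊗ e^{nα}`
with `φ` of charge `nα`. -/
def matched : Submodule ℂ (Φ ⊗[ℂ] GroupAlg) :=
  Submodule.span ℂ {u | ∃ n : ℤ, ∃ φ ∈ P.charge (n : ZMod k), u = φ ⊗ₜ[ℂ] e n}

/-- The module `V = S(𝔥'⁻) ⊗ Φ ⊗ ℂ(ℤα)` (with matching charges). -/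
def moduleV : Submodule ℂ (Tens Φ) :=
  Submodule.span ℂ {v | ∃ s : Fock, ∃ u ∈ matched P, v = s ⊗ₜ[ℂ] u}

/-- The operator `H(n)`, `n ∈ ℤ`, of level `-k`: it acts on the Fock space for `n ≠ 0`, and
`H(0)` acts on `ℂ(ℤα)` as `α(0)`. -/
def H (k : ℕ) (Φ : Type*) [AddCommGroup Φ] [Module ℂ Φ] (n : ℤ) : Module.End ℂ (Tens Φ) :=
  if h : 0 < n then
    LinearMap.rTensor _ (annihilation k ⟨n.toNat, by omega⟩)
  else if h' : n < 0 then
    LinearMap.rTensor _ (creation ⟨(-n).toNat, by omega⟩)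
  else LinearMap.lTensor _ (LinearMap.lTensor _ alphaZero)

/-- The vacuum space `Ω(V)`: the vectors of `V` killed by all `H(n)`, `n > 0`. -/
def vacuum : Submodule ℂ (Tens Φ) where
  carrier := {v | v ∈ moduleV P ∧ ∀ n : ℤ, 0 < n → H k Φ n v = 0}
  add_mem' := by
    rintro v w ⟨hv, hv'⟩ ⟨hw, hw'⟩
    exact ⟨add_mem hv hw, fun n hn => by rw [map_add, hv' n hn, hw' n hn, add_zero]⟩
  zero_mem' := ⟨zero_mem _, fun n _ => map_zero _⟩
  smul_mem' := by
    rintro c v ⟨hv, hv'⟩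
    exact ⟨Submodule.smul_mem _ c hv, fun n hn => by rw [map_smul, hv' n hn, smul_zero]⟩

/-- `E^{±}_+(z)` on the tensor product (`s = ±1`). -/
def Eplus (k : ℕ) (Φ : Type*) [AddCommGroup Φ] [Module ℂ Φ] (s : ℂ) : Field (Tens Φ) :=
  fun r => LinearMap.rTensor _ (fockEplus k s r)

/-- `E^{±}_-(z)` on the tensor product (`s = ±1`). -/
def Eminus (k : ℕ) (Φ : Type*) [AddCommGroup Φ] [Module ℂ Φ] (s : ℂ) : Field (Tens Φ) :=
  fun r => LinearMap.rTensor _ (fockEminus k s r)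

/-- `A(z)` acting on `Φ ⊗ ℂ(ℤα)` through the first factor. -/
def onFirst (F : Field Φ) : Field (Φ ⊗[ℂ] GroupAlg) := fun r => LinearMap.rTensor _ (F r)

/-- `e^{nα} z^{sα}` acting on `Φ ⊗ ℂ(ℤα)` through the second factor. -/
def lattice (Φ : Type*) [AddCommGroup Φ] [Module ℂ Φ] (n : ℤ) (s : ℚ) :
    Field (Φ ⊗[ℂ] GroupAlg) :=
  fun r => LinearMap.lTensor _ (eMul n * zPow s r)

/-- `A_α(z) e^α z^{-α/k}` on `Φ ⊗ ℂ(ℤα)`. -/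
def psiPlus : Field (Φ ⊗[ℂ] GroupAlg) := prod (onFirst P.A) (lattice Φ 1 (-1 / k))

/-- `A^*_{-α}(z) e^{-α} z^{α/k}` on `Φ ⊗ ℂ(ℤα)`. -/
def psiMinus : Field (Φ ⊗[ℂ] GroupAlg) := prod (onFirst P.A') (lattice Φ (-1) (1 / k))

/-- A series of operators on `Φ ⊗ ℂ(ℤα)`, acting on the whole tensor product. -/
def lift (F : Field (Φ ⊗[ℂ] GroupAlg)) : Field (Tens Φ) := fun r => LinearMap.lTensor _ (F r)

/-- `X(z) = E^+_+(z) E^+_-(z) ⊗ A_α(z) e^α z^{-α/k}`. -/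
def X : Field (Tens Φ) := prod (Eplus k Φ 1) (prod (Eminus k Φ 1) (lift (psiPlus P)))

/-- `Y(z) = E^-_+(z) E^-_-(z) ⊗ A^*_{-α}(z) e^{-α} z^{α/k}`. -/
def Y : Field (Tens Φ) := prod (Eplus k Φ (-1)) (prod (Eminus k Φ (-1)) (lift (psiMinus P)))

/-- `Z^+(z) = E^-_+(z) X(z) E^-_-(z)`. -/
def Zplus : Field (Tens Φ) := prod (Eplus k Φ (-1)) (prod (X P) (Eminus k Φ (-1)))

/-- `Z^-(z) = E^+_+(z) Y(z) E^+_-(z)`. -/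
def Zminus : Field (Tens Φ) := prod (Eplus k Φ 1) (prod (Y P) (Eminus k Φ 1))

/-- All products of formal series that occur in the definition of `Z^±(z)` exist. -/
def AllDefined : Prop :=
  (ProdDefined (onFirst P.A) (lattice Φ 1 (-1 / k)) ∧
    ProdDefined (onFirst P.A') (lattice Φ (-1) (1 / k))) ∧
  (ProdDefined (Eminus k Φ 1) (lift (psiPlus P)) ∧
    ProdDefined (Eplus k Φ 1) (prod (Eminus k Φ 1) (lift (psiPlus P)))) ∧
  (ProdDefined (Eminus k Φ (-1)) (lift (psiMinus P)) ∧
    ProdDefined (Eplus k Φ (-1)) (prod (Eminus k Φ (-1)) (lift (psiMinus P)))) ∧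
  (ProdDefined (X P) (Eminus k Φ (-1)) ∧
    ProdDefined (Eplus k Φ (-1)) (prod (X P) (Eminus k Φ (-1)))) ∧
  (ProdDefined (Y P) (Eminus k Φ 1) ∧
    ProdDefined (Eplus k Φ 1) (prod (Y P) (Eminus k Φ 1)))

end Module

/-! ### Representations of the `Z`-algebra -/

/-- The coefficient of `z^{-m} w^{-n}` in the generalized commutator
`F(z)G(w)(1 - w/z)^c - G(w)F(z)(1 - z/w)^c` applied to `x`, where
`F(z) = ∑ F m z^{-m}` and `G(w) = ∑ G n w^{-n}`. -/
def genComm {W : Type*} [AddCommGroup W] [Module ℂ W] (c : ℂ) (F G : ℤ → Module.End ℂ W)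
    (m n : ℤ) (x : W) : W :=
  (∑ᶠ j : ℕ, binom c j • F (m - j) (G (n + j) x)) -
    ∑ᶠ j : ℕ, binom c j • G (n - j) (F (m + j) x)

/-- The coefficient of `z^{-m} w^{-n}` in `δ(w/z) = ∑_j (w/z)^j`. -/
def delta (m n : ℤ) : ℂ := if m + n = 0 then 1 else 0

/-- The coefficient of `z^{-m} w^{-n}` in `w ∂_w δ(w/z)`. -/
def wdwDelta (m n : ℤ) : ℂ := (-(n : ℂ)) * delta m n

/-- A representation of the `Z`-algebra of `sl₂^` at level `l` on `W`: operators `H(0)` and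
`Z^±(z) = ∑_n Z^±(n) z^{-n}` on `W`, the latter truncated and of weight `±2`, with the
generalized commutator relations. The exponent of the bracket of `Z(φ₁,z)`, `Z(φ₂,w)` is
`⟨φ₁,φ₂⟩/l`, where `⟨α,α⟩ = 2`. -/
structure ZRep (l : ℂ) (W : Type*) [AddCommGroup W] [Module ℂ W] where
  H0 : Module.End ℂ W
  plus : ℤ → Module.End ℂ W
  minus : ℤ → Module.End ℂ W
  plus_truncated : ∀ x, ∃ N : ℤ, ∀ n, N < n → plus n x = 0
  minus_truncated : ∀ x, ∃ N : ℤ, ∀ n, N < n → minus n x = 0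
  H0_plus : ∀ n x, H0 (plus n x) - plus n (H0 x) = (2 : ℂ) • plus n x
  H0_minus : ∀ n x, H0 (minus n x) - minus n (H0 x) = (-2 : ℂ) • minus n x
  plus_plus : ∀ m n x, genComm (2 / l) plus plus m n x = 0
  minus_minus : ∀ m n x, genComm (2 / l) minus minus m n x = 0
  plus_minus : ∀ m n x, genComm (-2 / l) plus minus m n x =
    delta m n • H0 x + (l * wdwDelta m n) • x

end Zalg

end

/-! The vectors `1 ⊗ u` of the vacuum space see the Heisenberg part trivially. Every `E_-` fixes
them, since annihilation operators lower the weight and kill constants, and `E_-` commutes with the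
parafermion part. What is left is `E^∓_+ E^±_+ = 1`, an instance of `exp(f) exp(-f) = 1`. So
`Z^±(z)` reduces to `psiPlus`, `psiMinus` (`dressed_vertexOp_one_tmul`). That the vacuum consists of
such vectors holds because a polynomial with all partial derivatives zero is constant
(`eq_one_tmul_of_annihilation_eq_zero`). Here `k ≠ 0` is needed.

On `φ ⊗ e^{qα}` the factor `z^{∓α/k}` of the left field picks up an extra power of `z` from the
`e^{±α}` of the right field. It is exactly the `z^c` that turns `(1 - w/z)^c` into `(z - w)^c`, so a
generalized commutator becomes a difference of two expanded products of parafermion fields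
(`genComm_modes_vac`). For equal signs this difference is zero by the assumed symmetry.

For opposite signs, the two products agree only after multiplication by `(z - w)²`, which acts on
coefficients of fixed total degree as a second difference. One product vanishes far to the right in
the power of `z`, the other far to the left. Summation by parts then writes the difference of their
coefficients as the first moment of the common second difference (`sum_moment_second_difference`).
The two conditions on the diagonal `z = w` give the zeroth and first moments (`ope_sub_ope`), and
charge `q` turns the result into `2q` plus a multiple of the mode number, i.e. the delta terms. -/

noncomputable section

namespace Zalg

/-! ### Products of formal series -/

section Products

variable {W : Type*} [AddCommGroup W] [Module ℂ W] {F G : Field W}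

theorem prod_apply (h : ProdDefined F G) (r : ℚ) (v : W) :
    prod F G r v = ∑ᶠ a : ℚ, F a (G (r - a) v) := by
  rw [prod, dif_pos h]
  rfl

/-- The series involves only nonnegative integral powers. -/
def NatSupported (F : Field W) : Prop := ∀ r : ℚ, (∀ n : ℕ, r ≠ n) → F r = 0

/-- Each vector is killed by all but finitely many coefficients. -/
def LocallyFinite (F : Field W) : Prop := ∀ v : W, (Function.support fun a => F a v).Finite

theorem Truncated.exists_nat (hG : Truncated G) (r : ℚ) (v : W) :
    ∃ N : ℕ, ∀ n : ℕ, N ≤ n → G (r - n) v = 0 := by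
  obtain ⟨B, hB⟩ := hG v
  obtain ⟨N, hN⟩ := exists_nat_gt (r - B)
  refine ⟨N, fun n hn => hB _ ?_⟩
  have : (N : ℚ) ≤ n := by exact_mod_cast hn
  linarith

theorem NatSupported.support_subset (hF : NatSupported F) {r : ℚ} {v : W} {N : ℕ}
    (hN : ∀ n : ℕ, N ≤ n → G (r - n) v = 0) :
    (Function.support fun a : ℚ => F a (G (r - a) v)) ⊆
      ((Finset.range N).map Nat.castEmbedding : Finset ℚ) := by
  intro a ha
  obtain ⟨n, rfl⟩ : ∃ n : ℕ, a = n := by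
    by_contra! h
    exact ha (by simp [hF a h])
  have hn : n < N := by
    by_contra! h
    exact ha (by simp [hN n h])
  simpa using hn

theorem NatSupported.prodDefined (hF : NatSupported F) (hG : Truncated G) :
    ProdDefined F G := by
  intro r v
  obtain ⟨N, hN⟩ := hG.exists_nat r v
  exact (Finset.finite_toSet _).subset (hF.support_subset hN)

theorem NatSupported.prod_apply (hF : NatSupported F) (hG : Truncated G) {r : ℚ} {v : W} {N : ℕ}
    (hN : ∀ n : ℕ, N ≤ n → G (r - n) v = 0) :
    prod F G r v = ∑ n ∈ Finset.range N, F n (G (r - n) v) := by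
  rw [Zalg.prod_apply (hF.prodDefined hG),
    finsum_eq_sum_of_support_subset _ (hF.support_subset hN), Finset.sum_map]
  rfl

theorem NatSupported.truncated_prod (hF : NatSupported F) (hG : Truncated G) :
    Truncated (prod F G) := by
  intro v
  obtain ⟨B, hB⟩ := hG v
  refine ⟨B, fun r hr => ?_⟩
  rw [hF.prod_apply hG (N := 0) fun n _ => hB _ ?_]
  · simp
  · have : (0 : ℚ) ≤ n := by positivity
    linarith

theorem LocallyFinite.prodDefined_right (hG : LocallyFinite G) (F : Field W) :
    ProdDefined F G := by
  intro r v
  refine ((hG v).preimage (f := fun a => r - a) (sub_right_injective.injOn)).subset ?_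
  intro a ha h
  exact ha (by simp [h])

theorem LocallyFinite.truncated_prod_right (hG : LocallyFinite G) (hF : Truncated F) :
    Truncated (prod F G) := by
  intro v
  choose B hB using hF
  -- The truncation bound of `F` depends on the vector, but only finitely many vectors `G b v` are
  -- nonzero, so a common lower bound exists.
  obtain ⟨C, hC⟩ := ((hG v).image fun b => b + B (G b v)).bddBelow
  refine ⟨C, fun r hr => ?_⟩
  rw [Zalg.prod_apply (hG.prodDefined_right F)]
  refine finsum_eq_zero_of_forall_eq_zero fun a => ?_
  by_cases h : G (r - a) v = 0
  · simp [h]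
  · have := hC ⟨r - a, h, rfl⟩
    refine hB _ _ ?_
    simp only at this
    linarith

theorem prodDefined_of_commute (h : ∀ a b v, F a (G b v) = G b (F a v)) (hF : LocallyFinite F) :
    ProdDefined F G := by
  intro r v
  refine (hF v).subset ?_
  intro a ha h'
  exact ha (by simp [h, h'])

theorem prod_comm_apply (h : ∀ a b v, F a (G b v) = G b (F a v)) (hF : LocallyFinite F)
    (r : ℚ) (v : W) : prod F G r v = ∑ᶠ a : ℚ, G (r - a) (F a v) := by
  rw [prod_apply (prodDefined_of_commute h hF)]
  simp only [h]

theorem truncated_prod_of_commute (h : ∀ a b v, F a (G b v) = G b (F a v))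
    (hF : LocallyFinite F) (hG : Truncated G) : Truncated (prod F G) := by
  intro v
  choose B hB using hG
  obtain ⟨C, hC⟩ := ((hF v).image fun b => b + B (F b v)).bddBelow
  refine ⟨C, fun r hr => ?_⟩
  rw [prod_comm_apply h hF]
  refine finsum_eq_zero_of_forall_eq_zero fun a => ?_
  by_cases h' : F a v = 0
  · simp [h']
  · have := hC ⟨a, h', rfl⟩
    refine hB _ _ ?_
    simp only at this
    linarith

/-- The vectors on which a series is truncated. -/
def truncatedOn (F : Field W) : Submodule ℂ W where
  carrier := {v | ∃ B : ℚ, ∀ r : ℚ, r < B → F r v = 0}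
  add_mem' := by
    rintro v w ⟨B, hB⟩ ⟨C, hC⟩
    refine ⟨min B C, fun r hr => ?_⟩
    rw [map_add, hB r (hr.trans_le (min_le_left _ _)), hC r (hr.trans_le (min_le_right _ _)),
      add_zero]
  zero_mem' := ⟨0, fun r _ => map_zero _⟩
  smul_mem' := by
    rintro c v ⟨B, hB⟩
    exact ⟨B, fun r hr => by rw [map_smul, hB r hr, smul_zero]⟩

/-- The vectors on which the product of two series is defined. -/
def prodDefinedOn (F G : Field W) : Submodule ℂ W where
  carrier := {v | ∀ r : ℚ, (Function.support fun a : ℚ => F a (G (r - a) v)).Finite}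
  add_mem' := by
    intro v w hv hw r
    refine ((hv r).union (hw r)).subset ?_
    simp only [map_add]
    exact Function.support_add _ _
  zero_mem' := by simp [Function.support]
  smul_mem' := by
    intro c v hv r
    refine (hv r).subset ?_
    simp only [map_smul]
    exact Function.support_const_smul_subset _ _

/-- The vectors killed by all but finitely many coefficients of a series. -/
def locallyFiniteOn (F : Field W) : Submodule ℂ W where
  carrier := {v | (Function.support fun a => F a v).Finite}
  add_mem' := by
    intro v w hv hw
    refine (Set.Finite.union hv hw).subset ?_
    simp only [map_add]
    exact Function.support_add _ _
  zero_mem' := by simp [Function.support]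
  smul_mem' := by
    intro c v hv
    refine Set.Finite.subset hv ?_
    simp only [map_smul]
    exact Function.support_const_smul_subset _ _

end Products

/-! ### Operator products -/

section OPE

variable {W : Type*} [AddCommGroup W] [Module ℂ W] {F G : Field W}

theorem binom_zero (c : ℂ) : binom c 0 = 1 := by simp [binom]

theorem binom_succ (c : ℂ) (j : ℕ) : binom (c + 1) (j + 1) = binom c (j + 1) - binom c j := by
  simp only [binom, Ring.choose_succ_succ, pow_succ]
  ring

theorem ope_eq_sum {c : ℚ} {v : W} {a b : ℚ} {N : ℕ} (hN : ∀ j : ℕ, N ≤ j → G (b - j) v = 0) :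
    ope c F G v a b =
      ∑ j ∈ Finset.range N, binom (c : ℂ) j • F (a - c + j) (G (b - j) v) := by
  refine finsum_eq_sum_of_support_subset _ fun j hj => ?_
  by_contra h
  exact hj (by simp [hN j (by simpa using h)])

/-- Pascal's rule for the binomial series, i.e. `(z - w)^(c+1) = (z - w)(z - w)^c`. -/
theorem ope_add_one (hG : Truncated G) (c : ℚ) (v : W) (a b : ℚ) :
    ope (c + 1) F G v a b = ope c F G v (a - 1) b - ope c F G v a (b - 1) := by
  obtain ⟨N, hN⟩ := hG.exists_nat b v
  have hN' : ∀ n : ℕ, N ≤ n → G (b - 1 - n) v = 0 := fun n hn => by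
    have := hN (n + 1) (by omega)
    rwa [Nat.cast_add_one, add_comm (n : ℚ), ← sub_sub] at this
  -- The product shifted in `w` enters with its index moved by one, so the other two sums get one
  -- more term and their `j = 0` terms are split off.
  rw [ope_eq_sum (N := N + 1) fun n hn => hN n (by omega),
    ope_eq_sum (N := N + 1) fun n hn => hN n (by omega), ope_eq_sum hN', Finset.sum_range_succ',
    Finset.sum_range_succ' _ N, add_sub_right_comm, ← Finset.sum_sub_distrib]
  congr 1
  · refine Finset.sum_congr rfl fun j _ => ?_
    have e1 : a - (c + 1) + ((j + 1 : ℕ) : ℚ) = a - c + j := by push_cast; ring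
    have e2 : a - 1 - c + ((j + 1 : ℕ) : ℚ) = a - c + j := by push_cast; ring
    have e3 : b - 1 - (j : ℚ) = b - ((j + 1 : ℕ) : ℚ) := by push_cast; ring
    rw [e1, e2, e3, ← sub_smul, ← binom_succ]
    push_cast
    rfl
  · rw [binom_zero, binom_zero, sub_add_eq_sub_sub_swap]

theorem ope_add_two (hG : Truncated G) (c : ℚ) (v : W) (a b : ℚ) :
    ope (2 + c) F G v a b = ope c F G v (a - 2) b - (2 : ℂ) • ope c F G v (a - 1) (b - 1) +
      ope c F G v a (b - 2) := by
  have e1 : a - 1 - 1 = a - 2 := by ring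
  have e2 : b - 1 - 1 = b - 2 := by ring
  rw [show 2 + c = c + 1 + 1 by ring, ope_add_one hG, ope_add_one hG, ope_add_one hG, e1, e2]
  module

/-- The bound does not depend on `a`: along a line of fixed total degree the coefficients therefore
vanish once the power of the right-hand variable is low enough. -/
theorem Truncated.exists_ope_eq_zero (hG : Truncated G) (c : ℚ) (v : W) :
    ∃ B : ℚ, ∀ a b : ℚ, b < B → ope c F G v a b = 0 := by
  obtain ⟨B, hB⟩ := hG v
  refine ⟨B, fun a b hb => ?_⟩
  rw [ope_eq_sum (N := 0) fun j _ => hB _ ?_]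
  · simp
  · have : (0 : ℚ) ≤ j := by positivity
    linarith

theorem ope_ne_zero {c : ℚ} {v : W} {a b : ℚ} (h : ope c F G v a b ≠ 0) :
    ∃ j : ℕ, G (b - j) v ≠ 0 := by
  by_contra! h0
  exact h (by simp [ope, h0])

/-- Summation by parts, done twice. The terms at `T` are boundary terms, which disappear when `g`
vanishes from `T` on. -/
theorem sum_second_difference (g : ℤ → W) (T : ℕ) :
    ∑ i ∈ Finset.range T, ((i : ℂ) + 1) • (g i - (2 : ℂ) • g (i + 1) + g (i + 2)) =
      g 0 - ((T : ℂ) + 1) • g T + (T : ℂ) • g (T + 1) := by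
  induction T with
  | zero => simp
  | succ T ih =>
    rw [Finset.sum_range_succ, ih]
    push_cast
    rw [add_assoc (T : ℤ) 1 1, one_add_one_eq_two]
    module

end OPE

/-! ### Exponentials of power series -/

section Exp

variable {R : Type*} [Ring R]

theorem coeff_pow_of_lt {f : PowerSeries R} (hf : PowerSeries.coeff 0 f = 0) {n j : ℕ}
    (h : n < j) : PowerSeries.coeff n (f ^ j) = 0 := by
  have h1 : (1 : ℕ∞) ≤ f.order := by
    refine PowerSeries.nat_le_order f 1 fun i hi => ?_
    obtain rfl : i = 0 := by omega
    exact hf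
  refine PowerSeries.coeff_of_lt_order _ (lt_of_lt_of_le ?_ (PowerSeries.le_order_pow f j))
  calc (n : ℕ∞) < j := by exact_mod_cast h
    _ = j • 1 := by simp
    _ ≤ j • f.order := nsmul_le_nsmul_right h1 j

variable [Algebra ℂ R]

/-- Allows one cut-off `M` for all coefficients of degree below `M`, so that products of
exponentials become rectangular double sums. -/
theorem coeff_expSeries {f : PowerSeries R} (hf : PowerSeries.coeff 0 f = 0) {n M : ℕ}
    (h : n < M) : PowerSeries.coeff n (expSeries f) =
      ∑ j ∈ Finset.range M, ((j.factorial : ℂ)⁻¹) • PowerSeries.coeff n (f ^ j) := by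
  rw [expSeries, PowerSeries.coeff_mk]
  refine Finset.sum_subset (Finset.range_mono (by omega)) fun j _ hj => ?_
  rw [coeff_pow_of_lt hf (by simpa using hj), smul_zero]

theorem coeff_zero_expSeries (f : PowerSeries R) :
    PowerSeries.coeff 0 (expSeries f) = 1 := by
  simp [expSeries]

/-- No commutativity of `R` is needed, because only powers of the single series `f` occur.
Collecting the terms in `f^m` leaves `(1 - 1)^m / m!`. -/
theorem expSeries_mul_expSeries_neg {f : PowerSeries R} (hf : PowerSeries.coeff 0 f = 0) :
    expSeries f * expSeries (-f) = 1 := by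
  ext n
  have hf' : PowerSeries.coeff 0 (-f) = 0 := by rw [map_neg, hf, neg_zero]
  have h1 : ∀ p q : ℕ, ∑ x ∈ Finset.HasAntidiagonal.antidiagonal n,
      (((p.factorial : ℂ)⁻¹) • PowerSeries.coeff x.1 (f ^ p)) *
        (((q.factorial : ℂ)⁻¹) • PowerSeries.coeff x.2 ((-f) ^ q)) =
      ((p.factorial : ℂ)⁻¹ * (q.factorial : ℂ)⁻¹ * (-1) ^ q) •
        PowerSeries.coeff n (f ^ (p + q)) := by
    intro p q
    have : (-f) ^ q = ((-1 : ℂ) ^ q) • f ^ q := by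
      rw [← neg_one_smul ℂ f, smul_pow]
    simp only [this, PowerSeries.coeff_smul]
    simp only [smul_mul_smul_comm, ← Finset.smul_sum, pow_add, PowerSeries.coeff_mul, mul_assoc,
      smul_smul]
  rw [PowerSeries.coeff_mul]
  calc _ = ∑ x ∈ Finset.HasAntidiagonal.antidiagonal n,
        ∑ p ∈ Finset.range (n + 1), ∑ q ∈ Finset.range (n + 1), (((p.factorial : ℂ)⁻¹) • PowerSeries.coeff x.1 (f ^ p)) *
        (((q.factorial : ℂ)⁻¹) • PowerSeries.coeff x.2 ((-f) ^ q)) := by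
        refine Finset.sum_congr rfl fun x hx => ?_
        have := Finset.HasAntidiagonal.mem_antidiagonal.mp hx
        rw [coeff_expSeries hf (M := n + 1) (by omega),
          coeff_expSeries hf' (M := n + 1) (by omega), Finset.sum_mul_sum]
    _ = ∑ p ∈ Finset.range (n + 1), ∑ q ∈ Finset.range (n + 1),
        ((p.factorial : ℂ)⁻¹ * (q.factorial : ℂ)⁻¹ * (-1) ^ q) •
        PowerSeries.coeff n (f ^ (p + q)) := by
        rw [Finset.sum_comm]
        refine Finset.sum_congr rfl fun p _ => ?_
        rw [Finset.sum_comm]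
        exact Finset.sum_congr rfl fun q _ => h1 p q
    -- The terms with `p + q > n` vanish as `f` has no constant term; the remaining triangle is then
    -- summed along its diagonals `p + q = m`.
    _ = ∑ p ∈ Finset.range (n + 1), ∑ q ∈ Finset.range (n + 1 - p),
        ((p.factorial : ℂ)⁻¹ * (q.factorial : ℂ)⁻¹ * (-1) ^ q) •
        PowerSeries.coeff n (f ^ (p + q)) := by
        refine Finset.sum_congr rfl fun p _ => (Finset.sum_subset
          (Finset.range_mono (by omega)) fun q _ hq => ?_).symm
        have : ¬ q < n + 1 - p := by simpa using hq
        rw [coeff_pow_of_lt hf (by omega), smul_zero]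
    _ = ∑ m ∈ Finset.range (n + 1), ∑ p ∈ Finset.range (m + 1),
        ((p.factorial : ℂ)⁻¹ * ((m - p).factorial : ℂ)⁻¹ * (-1) ^ (m - p)) •
        PowerSeries.coeff n (f ^ m) := by
        rw [← Finset.sum_range_diag_flip]
        refine Finset.sum_congr rfl fun m _ => Finset.sum_congr rfl fun p hp => ?_
        rw [Nat.add_sub_cancel' (by simpa [Nat.lt_succ_iff] using hp)]
    _ = ∑ m ∈ Finset.range (n + 1), (if m = 0 then (1 : ℂ) else 0) •
        PowerSeries.coeff n (f ^ m) := by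
        refine Finset.sum_congr rfl fun m _ => ?_
        rw [← Finset.sum_smul]
        congr 1
        have h2 := add_pow (1 : ℂ) (-1) m
        rw [add_neg_cancel, zero_pow_eq] at h2
        have hm : (m.factorial : ℂ) ≠ 0 := by exact_mod_cast m.factorial_ne_zero
        rw [← mul_right_inj' hm, Finset.mul_sum]
        trans (if m = 0 then (1 : ℂ) else 0)
        · rw [h2]
          refine Finset.sum_congr rfl fun p hp => ?_
          rw [Nat.cast_choose ℂ (by simpa [Nat.lt_succ_iff] using hp)]
          field_simp
          simp
        · split_ifs with h
          · simp [h]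
          · simp
    _ = _ := by simp

end Exp

/-! ### The Fock space -/

section FockSpace

/-- The weight of a monomial of the Fock space, where `H(-n)` has weight `n`. -/
def fockWeight : (ℕ+ →₀ ℕ) →+ ℤ := Finsupp.weight fun i : ℕ+ => ((i : ℕ) : ℤ)

theorem fockWeight_nonneg (m : ℕ+ →₀ ℕ) : 0 ≤ fockWeight m := by
  rw [fockWeight, Finsupp.weight_apply]
  exact Finset.sum_nonneg fun i _ => by positivity

/-- The part of the Fock space of weight at most `d`. -/
def fockFiltration (d : ℤ) : Submodule ℂ Fock :=
  MvPolynomial.restrictSupport ℂ {m | fockWeight m ≤ d}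

theorem eq_zero_of_mem_fockFiltration {d : ℤ} (h : d < 0) {p : Fock}
    (hp : p ∈ fockFiltration d) : p = 0 := by
  rw [fockFiltration, MvPolynomial.mem_restrictSupport_iff] at hp
  rw [← MvPolynomial.support_eq_empty, Finset.eq_empty_iff_forall_notMem]
  intro m hm
  have h1 : fockWeight m ≤ d := hp hm
  have := fockWeight_nonneg m
  omega

theorem exists_mem_fockFiltration (p : Fock) : ∃ d : ℤ, p ∈ fockFiltration d := by
  obtain ⟨d, hd⟩ := (p.support.image fockWeight).bddAbove
  refine ⟨d, ?_⟩
  rw [fockFiltration, MvPolynomial.mem_restrictSupport_iff]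
  exact fun m hm => hd (by simpa using ⟨m, by simpa using hm, rfl⟩)

theorem one_mem_fockFiltration : (1 : Fock) ∈ fockFiltration 0 :=
  (MvPolynomial.monomial_mem_restrictSupport (R := ℂ) (m := (0 : ℕ+ →₀ ℕ)) (r := 1)).mpr
    (Or.inl (map_zero fockWeight).le)

theorem annihilation_mem (k : ℕ) (i : ℕ+) {d : ℤ} {p : Fock} (hp : p ∈ fockFiltration d) :
    annihilation k i p ∈ fockFiltration (d - (i : ℕ)) := by
  have : fockFiltration d ≤ (fockFiltration (d - (i : ℕ))).comap (annihilation k i) := by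
    conv_lhs => rw [fockFiltration, MvPolynomial.restrictSupport_eq_span]
    refine Submodule.span_le.mpr ?_
    rintro _ ⟨m, hm, rfl⟩
    change annihilation k i _ ∈ fockFiltration _
    refine Submodule.smul_mem _ _ ?_
    change MvPolynomial.pderiv i _ ∈ _
    rw [MvPolynomial.pderiv_monomial, fockFiltration, MvPolynomial.monomial_mem_restrictSupport]
    by_cases h : m i = 0
    · right
      simp [h]
    · left
      have hle : Finsupp.single i 1 ≤ m := by
        rw [Finsupp.single_le_iff]
        omega
      have h1 : fockWeight (m - Finsupp.single i 1) + fockWeight (Finsupp.single i 1) =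
          fockWeight m := by
        rw [← map_add, tsub_add_cancel_of_le hle]
      have h2 : fockWeight (Finsupp.single i 1) = (i : ℕ) := by
        simp [fockWeight, Finsupp.weight_single]
      have h3 : fockWeight m ≤ d := hm
      change fockWeight _ ≤ d - (i : ℕ)
      omega
  exact this hp

theorem coeff_annihilationSeries_mem (k n : ℕ) {d : ℤ} {p : Fock} (hp : p ∈ fockFiltration d) :
    PowerSeries.coeff n (annihilationSeries k) p ∈ fockFiltration (d - n) := by
  rw [annihilationSeries, PowerSeries.coeff_mk]
  split_ifs with h
  · exact Submodule.smul_mem _ _ (annihilation_mem k ⟨n, h⟩ hp)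
  · exact zero_mem _

theorem coeff_pow_mem {f : PowerSeries (Module.End ℂ Fock)}
    (hf : ∀ (n : ℕ) (d : ℤ), ∀ p ∈ fockFiltration d,
      PowerSeries.coeff n f p ∈ fockFiltration (d - n)) (j : ℕ) :
    ∀ (n : ℕ) (d : ℤ), ∀ p ∈ fockFiltration d,
      PowerSeries.coeff n (f ^ j) p ∈ fockFiltration (d - n) := by
  induction j with
  | zero =>
    intro n d p hp
    rw [pow_zero, PowerSeries.coeff_one]
    split_ifs with h
    · simpa [h] using hp
    · exact zero_mem _
  | succ j ih =>
    intro n d p hp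
    rw [pow_succ, PowerSeries.coeff_mul, LinearMap.sum_apply]
    refine Submodule.sum_mem _ fun x hx => ?_
    have h1 := ih x.1 _ _ (hf x.2 _ _ hp)
    have h2 := Finset.HasAntidiagonal.mem_antidiagonal.mp hx
    rwa [sub_sub, ← Nat.cast_add, add_comm x.2, h2] at h1

/-- The coefficient of `t^n` lowers the weight by `n`. As weights are nonnegative, only finitely
many coefficients of `E_-` act nontrivially on a given vector. -/
theorem coeff_expSeries_annihilationSeries_mem (k : ℕ) (s : ℂ) (n : ℕ) {d : ℤ} {p : Fock}
    (hp : p ∈ fockFiltration d) :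
    PowerSeries.coeff n (expSeries (s • annihilationSeries k)) p ∈ fockFiltration (d - n) := by
  rw [expSeries, PowerSeries.coeff_mk, LinearMap.sum_apply]
  refine Submodule.sum_mem _ fun j _ => Submodule.smul_mem _ _ (coeff_pow_mem ?_ j n d p hp)
  intro n d p hp
  rw [PowerSeries.coeff_smul]
  exact Submodule.smul_mem _ _ (coeff_annihilationSeries_mem k n hp)

theorem atZ_natCast {W : Type*} [AddCommGroup W] [Module ℂ W]
    (f : PowerSeries (Module.End ℂ W)) (n : ℕ) : atZ f n = PowerSeries.coeff n f := by
  simp [atZ]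

theorem natSupported_atZ {W : Type*} [AddCommGroup W] [Module ℂ W]
    (f : PowerSeries (Module.End ℂ W)) : NatSupported (atZ f) := by
  intro r hr
  rw [atZ, if_neg]
  rintro ⟨h1, h2⟩
  apply hr r.num.toNat
  have h3 : (r.num : ℚ) = r := Rat.coe_int_num_of_den_eq_one h1
  have h4 : ((r.num.toNat : ℤ) : ℚ) = r.num := by
    rw [Int.toNat_of_nonneg (Rat.num_nonneg.mpr h2)]
  rw [← Int.cast_natCast, h4, h3]

theorem fockEminus_ne_zero {k : ℕ} {s : ℂ} {r : ℚ} {p : Fock} {d : ℤ}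
    (hp : p ∈ fockFiltration d) (h : fockEminus k s r p ≠ 0) :
    ∃ n : ℕ, r = -n ∧ (n : ℤ) ≤ d := by
  rw [fockEminus, atZinv] at h
  obtain ⟨n, hn⟩ : ∃ n : ℕ, -r = n := by
    by_contra! h'
    exact h (by rw [natSupported_atZ _ _ h', LinearMap.zero_apply])
  refine ⟨n, by rw [← hn, neg_neg], ?_⟩
  by_contra! hd
  rw [hn, atZ_natCast] at h
  exact h (eq_zero_of_mem_fockFiltration (by omega)
    (coeff_expSeries_annihilationSeries_mem k s n hp))

theorem locallyFinite_fockEminus (k : ℕ) (s : ℂ) : LocallyFinite (fockEminus k s) := by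
  intro p
  obtain ⟨d, hd⟩ := exists_mem_fockFiltration p
  refine ((Set.finite_Iic d.toNat).image fun n : ℕ => -(n : ℚ)).subset fun r hr => ?_
  obtain ⟨n, rfl, hn⟩ := fockEminus_ne_zero hd hr
  exact ⟨n, by simp only [Set.mem_Iic]; omega, rfl⟩

theorem fockEminus_zero (k : ℕ) (s : ℂ) : fockEminus k s 0 = 1 := by
  rw [fockEminus, atZinv, neg_zero, ← Nat.cast_zero, atZ_natCast, coeff_zero_expSeries]

theorem fockEminus_one (k : ℕ) (s : ℂ) {r : ℚ} (hr : r ≠ 0) : fockEminus k s r 1 = 0 := by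
  by_contra h
  obtain ⟨n, rfl, hn⟩ := fockEminus_ne_zero one_mem_fockFiltration h
  obtain rfl : n = 0 := by omega
  simp at hr

theorem sum_fockEplus_mul (k : ℕ) (s : ℂ) (n : ℕ) :
    ∑ x ∈ Finset.HasAntidiagonal.antidiagonal n,
      fockEplus k (-s) (x.1 : ℕ) * fockEplus k s (x.2 : ℕ) = if n = 0 then 1 else 0 := by
  -- The double sign matches the definition of `fockEplus k (-s)`, whose exponent is `-(-s)` times
  -- the creation series.
  have h0 : PowerSeries.coeff 0 ((- -s) • creationSeries k) = 0 := by
    simp [creationSeries, -PowerSeries.coeff_zero_eq_constantCoeff]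
  have h := congrArg (PowerSeries.coeff n) (expSeries_mul_expSeries_neg h0)
  rw [PowerSeries.coeff_mul, PowerSeries.coeff_one] at h
  simpa only [fockEplus, atZ_natCast, neg_neg, neg_smul] using h

/-- If `H(-i)` occurs in the monomial `m`, the coefficient of `m` times the nonzero exponent `m i`
is a coefficient of the vanishing derivative in direction `i`. -/
theorem eq_C_of_annihilation_eq_zero {k : ℕ} (hk : 0 < k) {p : Fock}
    (h : ∀ i, annihilation k i p = 0) : p = MvPolynomial.C (MvPolynomial.constantCoeff p) := by
  have h' : ∀ i, MvPolynomial.pderiv i p = 0 := fun i => by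
    have h1 : (-(2 * (((i : ℕ+) : ℕ) : ℂ) * k)) • MvPolynomial.pderiv i p = 0 := h i
    rcases smul_eq_zero.mp h1 with h2 | h2
    · simp [hk.ne'] at h2
    · exact h2
  ext m
  rw [MvPolynomial.coeff_C]
  split_ifs with hm
  · rw [← hm, MvPolynomial.constantCoeff_eq]
  · obtain ⟨i, hi⟩ : ∃ i, m i ≠ 0 := by
      by_contra! h0
      exact hm (Finsupp.ext fun i => (h0 i).symm)
    have hle : Finsupp.single i 1 ≤ m := by
      rw [Finsupp.single_le_iff]
      omega
    have h1 := congrArg (MvPolynomial.coeff (m - Finsupp.single i 1)) (h' i)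
    rw [MvPolynomial.coeff_pderiv, tsub_add_cancel_of_le hle, MvPolynomial.coeff_zero] at h1
    refine (mul_eq_zero.mp h1).resolve_right ?_
    exact Nat.cast_add_one_ne_zero _

end FockSpace

/-! ### The lattice part -/

section Lattice

variable {Φ : Type*} [AddCommGroup Φ] [Module ℂ Φ]

theorem zPow_e (s r : ℚ) (n : ℤ) : zPow s r (e n) = if r = 2 * s * n then e n else 0 := by
  have h : e n = AddMonoidAlgebra.basis ℤ ℂ n := by rw [AddMonoidAlgebra.basis_apply]; rfl
  rw [zPow, h, Module.Basis.constr_basis, ← h]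

theorem alphaZero_e (n : ℤ) : alphaZero (e n) = (2 * (n : ℂ)) • e n := by
  have h : e n = AddMonoidAlgebra.basis ℤ ℂ n := by rw [AddMonoidAlgebra.basis_apply]; rfl
  rw [alphaZero, h, Module.Basis.constr_basis, ← h]

theorem eMul_e (m n : ℤ) : eMul m (e n) = e (m + n) := by
  rw [eMul, LinearMap.mulLeft_apply, e, e, AddMonoidAlgebra.single_mul_single, one_mul]
  rfl

/-- Conditions such as truncation or existence of a product cut out submodules, so they need
checking only on these vectors. -/
theorem mem_of_tmul_e {S : Submodule ℂ (Φ ⊗[ℂ] GroupAlg)}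
    (h : ∀ (φ : Φ) (n : ℤ), φ ⊗ₜ[ℂ] e n ∈ S) (u : Φ ⊗[ℂ] GroupAlg) : u ∈ S := by
  induction u with
  | zero => exact zero_mem _
  | add x y hx hy => exact add_mem hx hy
  | tmul φ g =>
    have : (⊤ : Submodule ℂ GroupAlg) ≤ S.comap (TensorProduct.mk ℂ Φ GroupAlg φ) := by
      rw [← (AddMonoidAlgebra.basis ℤ ℂ).span_eq, Submodule.span_le]
      rintro _ ⟨n, rfl⟩
      rw [AddMonoidAlgebra.basis_apply]
      exact h φ n
    exact this (Submodule.mem_top (x := g))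

theorem lattice_tmul_e (m : ℤ) (s r : ℚ) (φ : Φ) (n : ℤ) :
    lattice Φ m s r (φ ⊗ₜ e n) = if r = 2 * s * n then φ ⊗ₜ e (m + n) else 0 := by
  rw [lattice, LinearMap.lTensor_tmul, Module.End.mul_apply, zPow_e]
  split_ifs
  · rw [eMul_e]
  · rw [map_zero, TensorProduct.tmul_zero]

variable (F : Field Φ) (m : ℤ) (s : ℚ)

theorem prodDefined_onFirst_lattice : ProdDefined (onFirst F) (lattice Φ m s) := by
  have : ∀ u, u ∈ prodDefinedOn (onFirst F) (lattice Φ m s) := by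
    refine mem_of_tmul_e fun φ n r => ?_
    refine (Set.finite_singleton (r - 2 * s * n)).subset fun a ha => ?_
    by_contra h
    apply ha
    beta_reduce
    rw [lattice_tmul_e, if_neg, map_zero]
    rintro h'
    exact h (by rw [Set.mem_singleton_iff, ← h', sub_sub_cancel])
  exact fun r v => this v r

theorem prod_onFirst_lattice (r : ℚ) (φ : Φ) (n : ℤ) :
    prod (onFirst F) (lattice Φ m s) r (φ ⊗ₜ e n) = F (r - 2 * s * n) φ ⊗ₜ e (m + n) := by
  rw [prod_apply (prodDefined_onFirst_lattice F m s), finsum_eq_single _ (r - 2 * s * n)]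
  · rw [lattice_tmul_e, if_pos (by ring), onFirst, LinearMap.rTensor_tmul]
  · intro a ha
    rw [lattice_tmul_e, if_neg, map_zero]
    rintro h'
    exact ha (by rw [← h', sub_sub_cancel])

variable {F}

theorem truncated_prod_onFirst_lattice (hF : Truncated F) :
    Truncated (prod (onFirst F) (lattice Φ m s)) := by
  refine mem_of_tmul_e (S := truncatedOn _) fun φ n => ?_
  obtain ⟨B, hB⟩ := hF φ
  refine ⟨B + 2 * s * n, fun r hr => ?_⟩
  rw [prod_onFirst_lattice, hB _ (by linarith), TensorProduct.zero_tmul]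

end Lattice

/-! ### Vertex operators on the tensor product -/

section Vertex

variable {k : ℕ} {Φ : Type*} [AddCommGroup Φ] [Module ℂ Φ]

theorem mem_of_tmul {S : Submodule ℂ (Tens Φ)} (h : ∀ p u, p ⊗ₜ[ℂ] u ∈ S) (v : Tens Φ) :
    v ∈ S := by
  induction v using TensorProduct.induction_on with
  | zero => exact zero_mem _
  | add x y hx hy => exact add_mem hx hy
  | tmul p u => exact h p u

theorem natSupported_Eplus (s : ℂ) : NatSupported (Eplus k Φ s) := by
  intro r hr
  rw [Eplus, fockEplus, natSupported_atZ _ r hr, LinearMap.rTensor_zero]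

theorem locallyFinite_Eminus (s : ℂ) : LocallyFinite (Eminus k Φ s) := by
  refine mem_of_tmul (S := locallyFiniteOn _) fun p u => ?_
  refine (locallyFinite_fockEminus k s p).subset fun r hr h => hr ?_
  simp only at h
  simp only [Eminus, LinearMap.rTensor_tmul, h, TensorProduct.zero_tmul]

theorem Eminus_zero (s : ℂ) : Eminus k Φ s 0 = 1 := by
  rw [Eminus, fockEminus_zero]
  exact LinearMap.rTensor_id _ _

theorem Eminus_one_tmul (s : ℂ) {r : ℚ} (hr : r ≠ 0) (u : Φ ⊗[ℂ] GroupAlg) :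
    Eminus k Φ s r (1 ⊗ₜ u) = 0 := by
  rw [Eminus, LinearMap.rTensor_tmul, fockEminus_one k s hr, TensorProduct.zero_tmul]

theorem truncated_lift {ψ : Field (Φ ⊗[ℂ] GroupAlg)} (hψ : Truncated ψ) :
    Truncated (lift ψ) := by
  refine mem_of_tmul (S := truncatedOn _) fun p u => ?_
  obtain ⟨B, hB⟩ := hψ u
  refine ⟨B, fun r hr => ?_⟩
  rw [lift, LinearMap.lTensor_tmul, hB r hr, TensorProduct.tmul_zero]

theorem Eminus_lift_comm (s : ℂ) (ψ : Field (Φ ⊗[ℂ] GroupAlg)) (a b : ℚ) (v : Tens Φ) :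
    Eminus k Φ s a (lift ψ b v) = lift ψ b (Eminus k Φ s a v) := by
  rw [Eminus, lift, ← LinearMap.comp_apply, ← LinearMap.comp_apply,
    LinearMap.rTensor_comp_lTensor, LinearMap.lTensor_comp_rTensor]

theorem sum_Eplus_mul (s : ℂ) (n : ℕ) (v : Tens Φ) :
    ∑ x ∈ Finset.HasAntidiagonal.antidiagonal n,
      Eplus k Φ (-s) (x.1 : ℕ) (Eplus k Φ s (x.2 : ℕ) v) = if n = 0 then v else 0 := by
  have h := congrArg (fun f => LinearMap.rTensor (Φ ⊗[ℂ] GroupAlg) f v) (sum_fockEplus_mul k s n)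
  simp only [← LinearMap.coe_rTensorHom, map_sum, LinearMap.sum_apply] at h
  simp only [LinearMap.coe_rTensorHom, LinearMap.rTensor_mul] at h
  refine h.trans ?_
  split_ifs
  · exact LinearMap.congr_fun (LinearMap.rTensor_id _ _) v
  · rw [LinearMap.rTensor_zero, LinearMap.zero_apply]

variable (k) in
/-- The vertex operator `E^s_+(z) E^s_-(z) ⊗ ψ(z)`. -/
def vertexOp (s : ℂ) (ψ : Field (Φ ⊗[ℂ] GroupAlg)) : Field (Tens Φ) :=
  prod (Eplus k Φ s) (prod (Eminus k Φ s) (lift ψ))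

variable {ψ : Field (Φ ⊗[ℂ] GroupAlg)}

theorem prodDefined_Eminus_lift (s : ℂ) (ψ : Field (Φ ⊗[ℂ] GroupAlg)) :
    ProdDefined (Eminus k Φ s) (lift ψ) :=
  prodDefined_of_commute (Eminus_lift_comm s ψ) (locallyFinite_Eminus s)

theorem truncated_Eminus_lift (s : ℂ) (hψ : Truncated ψ) :
    Truncated (prod (Eminus k Φ s) (lift ψ)) :=
  truncated_prod_of_commute (Eminus_lift_comm s ψ) (locallyFinite_Eminus s) (truncated_lift hψ)

theorem prodDefined_vertexOp (s : ℂ) (hψ : Truncated ψ) :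
    ProdDefined (Eplus k Φ s) (prod (Eminus k Φ s) (lift ψ)) :=
  (natSupported_Eplus s).prodDefined (truncated_Eminus_lift s hψ)

theorem truncated_vertexOp (s : ℂ) (hψ : Truncated ψ) : Truncated (vertexOp k s ψ) :=
  (natSupported_Eplus s).truncated_prod (truncated_Eminus_lift s hψ)

theorem prodDefined_vertexOp_Eminus (s t : ℂ) (ψ : Field (Φ ⊗[ℂ] GroupAlg)) :
    ProdDefined (vertexOp k s ψ) (Eminus k Φ t) :=
  (locallyFinite_Eminus t).prodDefined_right _

theorem truncated_vertexOp_Eminus (s t : ℂ) (hψ : Truncated ψ) :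
    Truncated (prod (vertexOp k s ψ) (Eminus k Φ t)) :=
  (locallyFinite_Eminus t).truncated_prod_right (truncated_vertexOp s hψ)

theorem prodDefined_Eplus_vertexOp_Eminus (s t u : ℂ) (hψ : Truncated ψ) :
    ProdDefined (Eplus k Φ u) (prod (vertexOp k s ψ) (Eminus k Φ t)) :=
  (natSupported_Eplus u).prodDefined (truncated_vertexOp_Eminus s t hψ)

theorem Eminus_lift_one_tmul (s : ℂ) (r : ℚ) (u : Φ ⊗[ℂ] GroupAlg) :
    prod (Eminus k Φ s) (lift ψ) r (1 ⊗ₜ u) = 1 ⊗ₜ ψ r u := by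
  rw [prod_comm_apply (Eminus_lift_comm s ψ) (locallyFinite_Eminus s), finsum_eq_single _ 0]
  · rw [Eminus_zero, Module.End.one_apply, sub_zero, lift, LinearMap.lTensor_tmul]
  · intro a ha
    rw [Eminus_one_tmul s ha, map_zero]

theorem vertexOp_Eminus_one_tmul (s t : ℂ) (r : ℚ) (u : Φ ⊗[ℂ] GroupAlg) :
    prod (vertexOp k s ψ) (Eminus k Φ t) r (1 ⊗ₜ u) = vertexOp k s ψ r (1 ⊗ₜ u) := by
  rw [prod_apply (prodDefined_vertexOp_Eminus s t ψ), finsum_eq_single _ r]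
  · rw [sub_self, Eminus_zero, Module.End.one_apply]
  · intro a ha
    rw [Eminus_one_tmul t (sub_ne_zero.mpr ha.symm), map_zero]

/-- On `1 ⊗ u`, the exponentials surrounding a vertex operator cancel. -/
theorem dressed_vertexOp_one_tmul {s t : ℂ} (hst : t = -s) (hψ : Truncated ψ) (r : ℚ)
    (u : Φ ⊗[ℂ] GroupAlg) :
    prod (Eplus k Φ t) (prod (vertexOp k s ψ) (Eminus k Φ t)) r (1 ⊗ₜ u) = 1 ⊗ₜ ψ r u := by
  subst hst
  obtain ⟨N, hN⟩ := hψ.exists_nat r u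
  have h1 : ∀ m : ℕ, m ≤ N → vertexOp k s ψ (r - m) ((1 : Fock) ⊗ₜ[ℂ] u) =
      ∑ n ∈ Finset.range (N - m),
        Eplus k Φ s n ((1 : Fock) ⊗ₜ[ℂ] ψ (r - (m + n : ℕ)) u) := by
    intro m hm
    rw [vertexOp, (natSupported_Eplus s).prod_apply (truncated_Eminus_lift s hψ) (N := N - m)]
    · simp only [Eminus_lift_one_tmul, sub_sub, Nat.cast_add]
    · intro n hn
      rw [Eminus_lift_one_tmul, sub_sub, ← Nat.cast_add, hN _ (by omega),
        TensorProduct.tmul_zero]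
  have h2 : ∀ m : ℕ, N ≤ m → vertexOp k s ψ (r - m) ((1 : Fock) ⊗ₜ[ℂ] u) = 0 := by
    intro m hm
    rw [vertexOp, (natSupported_Eplus s).prod_apply (truncated_Eminus_lift s hψ) (N := 0)]
    · simp
    · intro n hn
      rw [Eminus_lift_one_tmul, sub_sub, ← Nat.cast_add, hN _ (by omega),
        TensorProduct.tmul_zero]
  rw [(natSupported_Eplus (-s)).prod_apply (truncated_vertexOp_Eminus s (-s) hψ) (N := N + 1)
    fun n hn => by rw [vertexOp_Eminus_one_tmul, h2 n (by omega)]]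
  simp only [vertexOp_Eminus_one_tmul]
  rw [Finset.sum_range_succ, h2 N le_rfl, map_zero, add_zero]
  -- Regrouping by the total power `d = m + n` taken from the two creation exponentials makes the
  -- inner sums coefficients of their product, which is `1`.
  calc _ = ∑ m ∈ Finset.range N, ∑ n ∈ Finset.range (N - m),
        Eplus k Φ (-s) m (Eplus k Φ s n ((1 : Fock) ⊗ₜ[ℂ] ψ (r - (m + n : ℕ)) u)) := by
        refine Finset.sum_congr rfl fun m hm => ?_
        rw [h1 m (Finset.mem_range.mp hm).le, map_sum]
    _ = ∑ d ∈ Finset.range N, ∑ x ∈ Finset.HasAntidiagonal.antidiagonal d,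
        Eplus k Φ (-s) (x.1 : ℕ)
          (Eplus k Φ s (x.2 : ℕ) ((1 : Fock) ⊗ₜ[ℂ] ψ (r - d) u)) := by
        rw [← Finset.sum_range_diag_flip N fun m n : ℕ =>
          Eplus k Φ (-s) m (Eplus k Φ s n ((1 : Fock) ⊗ₜ[ℂ] ψ (r - (m + n : ℕ)) u))]
        refine Finset.sum_congr rfl fun d _ => ?_
        rw [Finset.Nat.sum_antidiagonal_eq_sum_range_succ_mk]
        refine Finset.sum_congr rfl fun m hm => ?_
        rw [Nat.add_sub_cancel' (by simpa [Nat.lt_succ_iff] using hm)]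
    _ = ∑ d ∈ Finset.range N, if d = 0 then (1 : Fock) ⊗ₜ[ℂ] ψ (r - d) u else 0 :=
        Finset.sum_congr rfl fun d _ => sum_Eplus_mul s d _
    _ = _ := by
        rw [Finset.sum_ite_eq']
        split_ifs with h
        · simp
        -- Here `N = 0`: the sum is empty, and the right side is zero as well.
        · have := hN 0 (by simpa using h)
          rw [Nat.cast_zero, sub_zero] at this
          rw [this, TensorProduct.tmul_zero]

end Vertex

/-! ### The commutator of two fields with a double pole -/

section Commutator

variable {W : Type*} [AddCommGroup W] [Module ℂ W] {F G : Field W}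

/-- If the second differences of `g` and `g'` agree, `g` vanishes far to the right and `g'` far
to the left, then `g 0 - g' 0` is the first moment of the second difference. -/
theorem sum_moment_second_difference {g g' f : ℤ → W} {T : ℕ}
    (hf : ∀ t, f t = g (t - 1) - (2 : ℂ) • g t + g (t + 1))
    (hf' : ∀ t, f t = g' (t - 1) - (2 : ℂ) • g' t + g' (t + 1))
    (hg : ∀ t : ℤ, (T : ℤ) ≤ t → g t = 0) (hg' : ∀ t : ℤ, t ≤ -(T : ℤ) → g' t = 0) :
    ∑ i ∈ Finset.range (T + (T + 1)), ((i : ℂ) - T) • f (i - T) = g 0 - g' 0 := by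
  have h1 := sum_second_difference g T
  rw [hg T le_rfl, hg (T + 1) (by omega), smul_zero, smul_zero, sub_zero, add_zero] at h1
  have h2 := sum_second_difference (fun t => g' (-t)) T
  rw [hg' (-T) le_rfl, hg' (-(T + 1)) (by omega), smul_zero, smul_zero, sub_zero, add_zero,
    neg_zero] at h2
  -- With `t = i - T`, the range splits into `t < 0`, `t = 0` (weight zero) and `t > 0`. The
  -- positive part is summed by parts through `g`, the negative part, reflected, through `g'`.
  rw [Finset.sum_range_add, Finset.sum_range_succ', ← h1, ← h2]
  refine (add_comm _ _).trans ((congrArg₂ (· + ·) ?_ ?_).trans (sub_eq_add_neg _ _).symm)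
  · simp only [Nat.cast_add, add_zero, sub_self, zero_smul, Nat.cast_one]
    refine Finset.sum_congr rfl fun i _ => ?_
    have e1 : (T : ℤ) + (i + 1) - T = i + 1 := by ring
    rw [e1, hf, add_sub_cancel_right, add_sub_cancel_left, add_assoc, one_add_one_eq_two]
  · rw [← Finset.sum_range_reflect, ← Finset.sum_neg_distrib]
    refine Finset.sum_congr rfl fun i hi => ?_
    have hi' : i + 1 ≤ T := Finset.mem_range.mp hi
    have e1 : ((T - 1 - i : ℕ) : ℤ) = T - (i + 1) := by omega
    have e2 : ((T - 1 - i : ℕ) : ℂ) = T - (i + 1) := by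
      exact_mod_cast congrArg (Int.cast : ℤ → ℂ) e1
    have e3 : (T : ℤ) - (i + 1) - T = -(i + 1) := by ring
    have e4 : -((i : ℤ) + 1) - 1 = -(i + 2) := by ring
    have e5 : -((i : ℤ) + 1) + 1 = -i := by ring
    rw [e1, e2, e3, hf', e4, e5]
    module

/-- Along the line of total degree `a + b + 2`, the common series has zeroth and first moments both
equal to `-κ v` if `a + b = 0`, and to zero otherwise. Recentring the first moment at `z^(a+1)`
gives `-κ + (a + 1) κ = a κ`, and this recentred moment is the difference sought. The hypothesis
`hint` puts all exponents in one coset of `ℤ`. -/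
theorem ope_sub_ope (hF : Truncated F) (hG : Truncated G) {c : ℚ} {v : W} {κ : ℂ} {a b : ℚ}
    (hloc : ∀ x y, ope (2 + c) F G v x y = ope (2 + c) G F v y x)
    (hsing : VanishesTwice fun x y =>
      ope (2 + c) F G v x y + if x = 1 ∧ y = 1 then κ • v else 0)
    (hint : ∀ x, ope (2 + c) F G v x (a + b + 2 - x) ≠ 0 → ∃ t : ℤ, x = a + t) :
    ope c F G v a b - ope c G F v b a = if a + b = 0 then ((a : ℂ) * κ) • v else 0 := by
  obtain ⟨B, hB⟩ := hG.exists_ope_eq_zero (F := F) c v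
  obtain ⟨B', hB'⟩ := hF.exists_ope_eq_zero (F := G) c v
  obtain ⟨T, hT⟩ := exists_nat_gt (max (b - B) (a - B'))
  have hT1 := (le_max_left _ _).trans_lt hT
  have hT2 := (le_max_right _ _).trans_lt hT
  set g : ℤ → W := fun t => ope c F G v (a + t) (b - t) with hg
  set g' : ℤ → W := fun t => ope c G F v (b - t) (a + t) with hg'
  set f : ℤ → W := fun t => ope (2 + c) F G v (a + 1 + t) (b + 1 - t) with hf
  have g_zero : ∀ t : ℤ, (T : ℤ) ≤ t → g t = 0 := fun t ht => by
    have : (T : ℚ) ≤ t := by exact_mod_cast ht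
    exact hB _ _ (by linarith)
  have g'_zero : ∀ t : ℤ, t ≤ -(T : ℤ) → g' t = 0 := fun t ht => by
    have : (t : ℚ) ≤ -(T : ℚ) := by exact_mod_cast ht
    exact hB' _ _ (by linarith)
  have f_g : ∀ t, f t = g (t - 1) - (2 : ℂ) • g t + g (t + 1) := fun t => by
    simp only [hf, hg]
    rw [ope_add_two hG]
    push_cast
    ring_nf
  have f_g' : ∀ t, f t = g' (t - 1) - (2 : ℂ) • g' t + g' (t + 1) := fun t => by
    have : f t = g' (t + 1) - (2 : ℂ) • g' t + g' (t - 1) := by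
      simp only [hf, hg']
      rw [hloc, ope_add_two hF]
      push_cast
      ring_nf
    rw [this]
    abel
  -- The right tail vanishes by the expansion through `g`, the left tail by the one through `g'`;
  -- this makes the diagonal sums finite.
  have f_zero : ∀ t : ℤ, (T : ℤ) < t ∨ t < -(T : ℤ) → f t = 0 := by
    rintro t (ht | ht)
    · rw [f_g, g_zero _ (by omega), g_zero _ (by omega), g_zero _ (by omega)]
      simp
    · rw [f_g', g'_zero _ (by omega), g'_zero _ (by omega), g'_zero _ (by omega)]
      simp
  have key := sum_moment_second_difference f_g f_g' g_zero g'_zero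
  have hg0 : g 0 = ope c F G v a b := by simp [hg]
  have hg'0 : g' 0 = ope c G F v b a := by simp [hg']
  rw [hg0, hg'0] at key
  rw [← key]
  -- The `2T + 1` exponents of `z` that can contribute, centred at `a + 1`.
  obtain ⟨x, x_apply⟩ : ∃ x : ℕ ↪ ℚ, ∀ i, x i = a + 1 + (i - T) :=
    ⟨⟨fun i => a + 1 + (i - T), fun i j h => by simpa using h⟩, fun _ => rfl⟩
  have hsupp : (Function.support fun y : ℚ => ope (2 + c) F G v y (a + b + 2 - y)) ⊆
      ((Finset.range (T + (T + 1))).map x : Finset ℚ) := by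
    intro y hy
    obtain ⟨t, rfl⟩ := hint y hy
    have h1 : f (t - 1) ≠ 0 := by
      intro h
      apply hy
      rw [← h]
      simp only [hf]
      push_cast
      ring_nf
    have h2 : -(T : ℤ) ≤ t - 1 ∧ t - 1 ≤ T := by
      by_contra h
      exact h1 (f_zero _ (by omega))
    simp only [Finset.coe_map, Finset.coe_range, Set.mem_image, Set.mem_Iio]
    refine ⟨(t - 1 + T).toNat, by omega, ?_⟩
    have h3 : (((t - 1 + T).toNat : ℤ) : ℚ) = ((t - 1 + T : ℤ) : ℚ) := by
      rw [Int.toNat_of_nonneg (by omega)]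
    rw [x_apply, ← Int.cast_natCast, h3]
    push_cast
    ring
  have hx : ∀ i : ℕ, ope (2 + c) F G v (x i) (a + b + 2 - x i) = f (i - T) := fun i => by
    simp only [x_apply, hf]
    push_cast
    congr 1
    ring
  have hpole : ∀ w : ℚ → ℂ, (∑ᶠ y : ℚ, w y • if y = 1 ∧ a + b + 2 - y = 1 then κ • v else 0) =
      w 1 • if a + b = 0 then κ • v else 0 := fun w => by
    rw [finsum_eq_single _ 1 fun y hy => by rw [if_neg (fun h => hy h.1), smul_zero]]
    have : a + b + 2 - 1 = 1 ↔ a + b = 0 := ⟨fun h => by linarith, fun h => by linarith⟩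
    simp only [true_and, this]
  have hmoment : ∀ w : ℚ → ℂ,
      (∑ᶠ y : ℚ, w y • (ope (2 + c) F G v y (a + b + 2 - y) +
        if y = 1 ∧ a + b + 2 - y = 1 then κ • v else 0)) =
      ∑ i ∈ Finset.range (T + (T + 1)), w (x i) • f (i - T) +
        w 1 • if a + b = 0 then κ • v else 0 := fun w => by
    have hs : (Function.support fun y : ℚ => w y • ope (2 + c) F G v y (a + b + 2 - y)) ⊆
        ((Finset.range (T + (T + 1))).map x : Finset ℚ) :=
      (Function.support_smul_subset_right _ _).trans hsupp
    simp only [smul_add]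
    rw [finsum_add_distrib, hpole, finsum_eq_sum_of_support_subset _ hs, Finset.sum_map]
    · simp only [hx]
    · exact (Finset.finite_toSet _).subset hs
    · refine (Set.finite_singleton 1).subset fun y hy => ?_
      by_contra h
      refine hy ?_
      beta_reduce
      rw [if_neg fun h' => h h'.1, smul_zero]
  -- Weight `1` is restriction to the diagonal; weight `y` is restriction after `z ∂_z`.
  have h0 := hmoment 1
  have h1 := hmoment fun y => (y : ℂ)
  simp only [Pi.one_apply, one_smul] at h0
  rw [(hsing _).1] at h0
  rw [(hsing _).2] at h1
  have h2 : ∑ i ∈ Finset.range (T + (T + 1)), ((x i : ℚ) : ℂ) • f (i - T) =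
      ((a : ℂ) + 1) • ∑ i ∈ Finset.range (T + (T + 1)), f (i - T) +
      ∑ i ∈ Finset.range (T + (T + 1)), ((i : ℂ) - T) • f (i - T) := by
    rw [Finset.smul_sum, ← Finset.sum_add_distrib]
    refine Finset.sum_congr rfl fun i _ => ?_
    rw [← add_smul]
    congr 1
    rw [x_apply]
    push_cast
    ring
  rw [h2, eq_neg_of_add_eq_zero_left h0.symm] at h1
  rw [Rat.cast_one] at h1
  have h3 : ∑ i ∈ Finset.range (T + (T + 1)), ((i : ℂ) - T) • f (i - T) =
      (a : ℂ) • if a + b = 0 then κ • v else 0 := by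
    generalize (if a + b = 0 then κ • v else 0) = p at h1 ⊢
    rw [← sub_eq_zero, h1]
    module
  rw [h3, smul_ite, smul_zero, smul_smul]

end Commutator

/-! ### Generalized commutators -/

section GenComm

variable {W : Type*} [AddCommGroup W] [Module ℂ W] {c : ℂ} {F G : ℤ → Module.End ℂ W}

theorem finite_support_genComm (c : ℂ) (F : ℤ → Module.End ℂ W)
    (hG : ∀ x, ∃ N : ℤ, ∀ n, N < n → G n x = 0) (m n : ℤ) (x : W) :
    (Function.support fun j : ℕ => binom c j • F (m - j) (G (n + j) x)).Finite := by
  obtain ⟨N, hN⟩ := hG x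
  refine (Set.finite_Iic (N - n).toNat).subset fun j hj => ?_
  by_contra h
  have h' : (N - n).toNat < j := by simpa using h
  exact hj (by simp [hN (n + j) (by omega)])

/-- The generalized commutator of truncated series, as a linear operator. -/
def genCommHom (c : ℂ) (hF : ∀ x, ∃ N : ℤ, ∀ n, N < n → F n x = 0)
    (hG : ∀ x, ∃ N : ℤ, ∀ n, N < n → G n x = 0) (m n : ℤ) : Module.End ℂ W where
  toFun := genComm c F G m n
  map_add' x y := by
    simp only [genComm, map_add, smul_add]
    rw [finsum_add_distrib (finite_support_genComm c F hG m n x)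
      (finite_support_genComm c F hG m n y),
      finsum_add_distrib (finite_support_genComm c G hF n m x)
      (finite_support_genComm c G hF n m y)]
    abel
  map_smul' a x := by
    simp only [genComm, map_smul, RingHom.id_apply, smul_comm _ a]
    rw [← smul_finsum, ← smul_finsum, smul_sub]

/-- No finiteness is required: the inclusion is injective, hence commutes with `finsum` even at its
default value. -/
theorem coe_genComm {S : Submodule ℂ W} {F' G' : ℤ → Module.End ℂ S}
    (hF : ∀ n x, (F' n x : W) = F n x) (hG : ∀ n x, (G' n x : W) = G n x) (c : ℂ) (m n : ℤ)
    (x : S) : ((genComm c F' G' m n x : S) : W) = genComm c F G m n x := by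
  have h : ∀ f : ℕ → S, ((∑ᶠ j, f j : S) : W) = ∑ᶠ j, (f j : W) := fun f =>
    AddMonoidHom.map_finsum_of_injective S.subtype.toAddMonoidHom Subtype.val_injective f
  simp only [genComm, Submodule.coe_sub, h, Submodule.coe_smul, hF, hG]

end GenComm

/-! ### The vacuum space -/

section Vacuum

variable {k : ℕ} {Φ : Type*} [AddCommGroup Φ] [Module ℂ Φ]

/-- The vector `1 ⊗ φ ⊗ e^{qα}`. -/
def vac (q : ℤ) : Φ →ₗ[ℂ] Tens Φ :=
  TensorProduct.mk ℂ Fock (Φ ⊗[ℂ] GroupAlg) 1 ∘ₗ (TensorProduct.mk ℂ Φ GroupAlg).flip (e q)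

theorem vac_apply (q : ℤ) (φ : Φ) : vac q φ = (1 : Fock) ⊗ₜ[ℂ] (φ ⊗ₜ[ℂ] e q) := rfl

theorem matched_le (P : Parafermion k Φ) {S : Submodule ℂ (Φ ⊗[ℂ] GroupAlg)}
    (h : ∀ n : ℤ, ∀ φ ∈ P.charge (n : ZMod k), φ ⊗ₜ[ℂ] e n ∈ S) : matched P ≤ S := by
  rw [matched, Submodule.span_le]
  rintro _ ⟨n, φ, hφ, rfl⟩
  exact h n φ hφ

theorem tmul_e_mem_matched (P : Parafermion k Φ) {n : ℤ} {φ : Φ}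
    (hφ : φ ∈ P.charge (n : ZMod k)) : φ ⊗ₜ[ℂ] e n ∈ matched P :=
  Submodule.subset_span ⟨n, φ, hφ, rfl⟩

/-- The projection of the tensor product to the Fock vacuum. -/
def vacuumPart (Φ : Type*) [AddCommGroup Φ] [Module ℂ Φ] : Tens Φ →ₗ[ℂ] Φ ⊗[ℂ] GroupAlg :=
  (TensorProduct.lid ℂ (Φ ⊗[ℂ] GroupAlg)).toLinearMap ∘ₗ
    LinearMap.rTensor _ (MvPolynomial.aeval (R := ℂ) fun _ : ℕ+ => (0 : ℂ)).toLinearMap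

theorem vacuumPart_tmul (p : Fock) (u : Φ ⊗[ℂ] GroupAlg) :
    vacuumPart Φ (p ⊗ₜ u) = MvPolynomial.constantCoeff p • u := by
  simp [vacuumPart]

theorem vacuumPart_mem_matched (P : Parafermion k Φ) {v : Tens Φ} (hv : v ∈ moduleV P) :
    vacuumPart Φ v ∈ matched P := by
  have : moduleV P ≤ (matched P).comap (vacuumPart Φ) := by
    rw [moduleV, Submodule.span_le]
    rintro _ ⟨s, u, hu, rfl⟩
    change vacuumPart Φ _ ∈ matched P
    rw [vacuumPart_tmul]
    exact Submodule.smul_mem _ _ hu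
  exact this hv

/-- A basis of the right factor turns a tensor into a finite family of polynomials on which the
annihilation operators act componentwise. Each component is then constant. -/
theorem eq_one_tmul_of_annihilation_eq_zero (hk : 0 < k) {v : Tens Φ}
    (h : ∀ i, LinearMap.rTensor (Φ ⊗[ℂ] GroupAlg) (annihilation k i) v = 0) :
    v = (1 : Fock) ⊗ₜ[ℂ] vacuumPart Φ v := by
  classical
  let b := Module.Basis.ofVectorSpace ℂ (Φ ⊗[ℂ] GroupAlg)
  let E := TensorProduct.equivFinsuppOfBasisRight (M := Fock) b
  have hE : ∀ (f : Module.End ℂ Fock) (w : Tens Φ) i,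
      E (LinearMap.rTensor _ f w) i = f (E w i) := by
    intro f w i
    induction w using TensorProduct.induction_on with
    | zero => simp
    | add x y hx hy => simp only [map_add, Finsupp.add_apply, hx, hy]
    | tmul p u => simp [E]
  let π : Module.End ℂ Fock := (Algebra.linearMap ℂ Fock) ∘ₗ
    (MvPolynomial.aeval (R := ℂ) fun _ : ℕ+ => (0 : ℂ)).toLinearMap
  have hπ : ∀ p, π p = MvPolynomial.C (MvPolynomial.constantCoeff p) := by
    intro p
    simp [π, MvPolynomial.algebraMap_eq]
  have h1 : LinearMap.rTensor _ π v = v := by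
    apply E.injective
    ext1 i
    rw [hE, hπ]
    refine (eq_C_of_annihilation_eq_zero hk fun j => ?_).symm
    rw [← hE, h j, map_zero, Finsupp.zero_apply]
  have h2 : ∀ w : Tens Φ, LinearMap.rTensor _ π w = (1 : Fock) ⊗ₜ[ℂ] vacuumPart Φ w := by
    intro w
    induction w using TensorProduct.induction_on with
    | zero => simp
    | add x y hx hy => simp only [map_add, TensorProduct.tmul_add, hx, hy]
    | tmul p u =>
      rw [LinearMap.rTensor_tmul, hπ, vacuumPart_tmul, ← TensorProduct.smul_tmul,
        MvPolynomial.C_eq_smul_one]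
  rw [← h2, h1]

theorem H_of_pos {n : ℤ} (h : 0 < n) :
    H k Φ n = LinearMap.rTensor _ (annihilation k ⟨n.toNat, by omega⟩) := by
  rw [H, dif_pos h]

theorem H_zero : H k Φ 0 = LinearMap.lTensor _ (LinearMap.lTensor _ alphaZero) := by
  rw [H, dif_neg (lt_irrefl _), dif_neg (lt_irrefl _)]

theorem mem_vacuum_iff (hk : 0 < k) (P : Parafermion k Φ) (v : Tens Φ) :
    v ∈ vacuum P ↔ ∃ u ∈ matched P, v = (1 : Fock) ⊗ₜ[ℂ] u := by
  constructor
  · rintro ⟨hv, hH⟩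
    refine ⟨_, vacuumPart_mem_matched P hv, eq_one_tmul_of_annihilation_eq_zero hk fun i => ?_⟩
    have h := hH (i : ℕ) (by exact_mod_cast i.pos)
    rw [H_of_pos (by exact_mod_cast i.pos)] at h
    exact h
  · rintro ⟨u, hu, rfl⟩
    refine ⟨Submodule.subset_span ⟨1, u, hu, rfl⟩, fun n hn => ?_⟩
    rw [H_of_pos hn, LinearMap.rTensor_tmul]
    simp [annihilation]

theorem vacuum_le (hk : 0 < k) (P : Parafermion k Φ) {S : Submodule ℂ (Tens Φ)}
    (h : ∀ q : ℤ, ∀ φ ∈ P.charge (q : ZMod k), vac q φ ∈ S) : vacuum P ≤ S := by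
  intro v hv
  obtain ⟨u, hu, rfl⟩ := (mem_vacuum_iff hk P v).mp hv
  exact matched_le P (S := S.comap (TensorProduct.mk ℂ Fock (Φ ⊗[ℂ] GroupAlg) 1)) h hu

theorem lTensor_mem_vacuum (hk : 0 < k) (P : Parafermion k Φ)
    {f : Module.End ℂ (Φ ⊗[ℂ] GroupAlg)} (hf : matched P ≤ (matched P).comap f) {v : Tens Φ}
    (hv : v ∈ vacuum P) : LinearMap.lTensor Fock f v ∈ vacuum P := by
  rw [mem_vacuum_iff hk] at hv ⊢
  obtain ⟨u, hu, rfl⟩ := hv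
  exact ⟨f u, hf hu, LinearMap.lTensor_tmul _ _ _ _⟩

theorem H_zero_vac (q : ℤ) (φ : Φ) : H k Φ 0 (vac q φ) = (2 * (q : ℂ)) • vac q φ := by
  rw [H_zero, vac_apply, LinearMap.lTensor_tmul, LinearMap.lTensor_tmul, alphaZero_e,
    TensorProduct.tmul_smul, TensorProduct.tmul_smul]

theorem H_zero_mem_vacuum (hk : 0 < k) (P : Parafermion k Φ) {v : Tens Φ}
    (hv : v ∈ vacuum P) : H k Φ 0 v ∈ vacuum P := by
  rw [H_zero]
  refine lTensor_mem_vacuum hk P (matched_le P fun n φ hφ => ?_) hv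
  rw [Submodule.mem_comap, LinearMap.lTensor_tmul, alphaZero_e, TensorProduct.tmul_smul]
  exact Submodule.smul_mem _ _ (tmul_e_mem_matched P hφ)

end Vacuum

/-! ### Modes on the vacuum space -/

section Modes

variable {k : ℕ} {Φ : Type*} [AddCommGroup Φ] [Module ℂ Φ]

/-- The coefficient of `z^{-n}` of `ψ(z)`, acting on the whole tensor product. -/
def modes (ψ : Field (Φ ⊗[ℂ] GroupAlg)) (n : ℤ) : Module.End ℂ (Tens Φ) := lift ψ (-n : ℚ)

theorem modes_truncated {ψ : Field (Φ ⊗[ℂ] GroupAlg)} (hψ : Truncated ψ) (x : Tens Φ) :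
    ∃ N : ℤ, ∀ n, N < n → modes ψ n x = 0 := by
  obtain ⟨B, hB⟩ := truncated_lift hψ x
  refine ⟨⌈-B⌉, fun n hn => hB _ ?_⟩
  have h1 := Int.le_ceil (-B)
  have h2 : ((⌈-B⌉ : ℤ) : ℚ) < n := by exact_mod_cast hn
  linarith

variable {F G : Field Φ} {M M' : ℤ} {s s' : ℚ}

theorem modes_vac (n q : ℤ) (φ : Φ) :
    modes (prod (onFirst F) (lattice Φ M s)) n (vac q φ) =
      vac (M + q) (F (-n - 2 * s * q) φ) := by
  rw [modes, lift, vac_apply, LinearMap.lTensor_tmul, prod_onFirst_lattice, vac_apply]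

theorem map_ope (hG : Truncated G) (f : Φ →ₗ[ℂ] Tens Φ) (c : ℚ) (φ : Φ) (a b : ℚ) :
    f (ope c F G φ a b) = ∑ᶠ j : ℕ, binom (c : ℂ) j • f (F (a - c + j) (G (b - j) φ)) := by
  obtain ⟨N, hN⟩ := hG.exists_nat b φ
  have hs : (Function.support fun j : ℕ =>
      binom (c : ℂ) j • f (F (a - c + j) (G (b - j) φ))) ⊆ (Finset.range N : Finset ℕ) := by
    intro j hj
    by_contra h
    exact hj (by simp [hN j (by simpa using h)])
  rw [ope_eq_sum hN, map_sum, finsum_eq_sum_of_support_subset _ hs]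
  simp only [map_smul]

/-- The left field meets charge `M' + q` rather than `q`; the excess `2 s M'` is the shift by `c`
built into `ope`. -/
theorem finsum_modes_vac (hG : Truncated G) {c : ℚ} (hc : c = 2 * s * M') (m n q : ℤ) (φ : Φ) :
    (∑ᶠ j : ℕ, binom (c : ℂ) j • modes (prod (onFirst F) (lattice Φ M s)) (m - j)
      (modes (prod (onFirst G) (lattice Φ M' s')) (n + j) (vac q φ))) =
    vac (M + (M' + q)) (ope c F G φ (-m - 2 * s * q) (-n - 2 * s' * q)) := by
  rw [map_ope hG]
  refine finsum_congr fun j => ?_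
  rw [modes_vac, modes_vac]
  congr 4
  · push_cast
    rw [hc]
    ring
  · congr 1
    push_cast
    ring

theorem genComm_modes_vac (hF : Truncated F) (hG : Truncated G) {c : ℚ} (hc : c = 2 * s * M')
    (hc' : c = 2 * s' * M) (m n q : ℤ) (φ : Φ) :
    genComm (c : ℂ) (modes (prod (onFirst F) (lattice Φ M s)))
      (modes (prod (onFirst G) (lattice Φ M' s'))) m n (vac q φ) =
    vac (M + (M' + q)) (ope c F G φ (-m - 2 * s * q) (-n - 2 * s' * q) -
      ope c G F φ (-n - 2 * s' * q) (-m - 2 * s * q)) := by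
  rw [genComm, finsum_modes_vac hG hc, finsum_modes_vac hF hc', map_sub, add_left_comm M' M q]

end Modes

/-! ### The representation of the `Z`-algebra -/

section Representation

variable {k : ℕ} {Φ : Type*} [AddCommGroup Φ] [Module ℂ Φ] (P : Parafermion k Φ)

theorem truncated_psiPlus : Truncated (psiPlus P) :=
  truncated_prod_onFirst_lattice _ _ P.A_truncated

theorem truncated_psiMinus : Truncated (psiMinus P) :=
  truncated_prod_onFirst_lattice _ _ P.A'_truncated

theorem allDefined : AllDefined P :=
  have hp := truncated_psiPlus P
  have hm := truncated_psiMinus P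
  ⟨⟨prodDefined_onFirst_lattice _ _ _, prodDefined_onFirst_lattice _ _ _⟩,
    ⟨prodDefined_Eminus_lift _ _, prodDefined_vertexOp _ hp⟩,
    ⟨prodDefined_Eminus_lift _ _, prodDefined_vertexOp _ hm⟩,
    ⟨prodDefined_vertexOp_Eminus _ _ _, prodDefined_Eplus_vertexOp_Eminus _ _ _ hp⟩,
    ⟨prodDefined_vertexOp_Eminus _ _ _, prodDefined_Eplus_vertexOp_Eminus _ _ _ hm⟩⟩

theorem Zplus_one_tmul (r : ℚ) (u : Φ ⊗[ℂ] GroupAlg) :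
    Zplus P r ((1 : Fock) ⊗ₜ[ℂ] u) = (1 : Fock) ⊗ₜ[ℂ] psiPlus P r u :=
  dressed_vertexOp_one_tmul rfl (truncated_psiPlus P) r u

theorem Zminus_one_tmul (r : ℚ) (u : Φ ⊗[ℂ] GroupAlg) :
    Zminus P r ((1 : Fock) ⊗ₜ[ℂ] u) = (1 : Fock) ⊗ₜ[ℂ] psiMinus P r u :=
  dressed_vertexOp_one_tmul (neg_neg 1).symm (truncated_psiMinus P) r u

theorem psiPlus_tmul_e (r : ℚ) (φ : Φ) (n : ℤ) :
    psiPlus P r (φ ⊗ₜ e n) = P.A (r + 2 * n / k) φ ⊗ₜ e (1 + n) := by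
  rw [psiPlus, prod_onFirst_lattice]
  congr 3
  ring

theorem psiMinus_tmul_e (r : ℚ) (φ : Φ) (n : ℤ) :
    psiMinus P r (φ ⊗ₜ e n) = P.A' (r - 2 * n / k) φ ⊗ₜ e (-1 + n) := by
  rw [psiMinus, prod_onFirst_lattice]
  congr 3
  ring

theorem psiPlus_eq_zero {r : ℚ} (hr : ∀ m : ℤ, r ≠ m) {u : Φ ⊗[ℂ] GroupAlg}
    (hu : u ∈ matched P) : psiPlus P r u = 0 := by
  refine LinearMap.mem_ker.mp (matched_le P (fun n φ hφ => LinearMap.mem_ker.mpr ?_) hu)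
  rw [psiPlus_tmul_e]
  by_cases h : P.A (r + 2 * n / k) φ = 0
  · rw [h, TensorProduct.zero_tmul]
  · obtain ⟨m, hm⟩ := P.A_exponent n _ φ hφ h
    exact absurd (by linarith) (hr m)

theorem psiMinus_eq_zero {r : ℚ} (hr : ∀ m : ℤ, r ≠ m) {u : Φ ⊗[ℂ] GroupAlg}
    (hu : u ∈ matched P) : psiMinus P r u = 0 := by
  refine LinearMap.mem_ker.mp (matched_le P (fun n φ hφ => LinearMap.mem_ker.mpr ?_) hu)
  rw [psiMinus_tmul_e]
  by_cases h : P.A' (r - 2 * n / k) φ = 0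
  · rw [h, TensorProduct.zero_tmul]
  · obtain ⟨m, hm⟩ := P.A'_exponent n _ φ hφ h
    exact absurd (by linarith) (hr m)

theorem modes_psiPlus_mem_vacuum (hk : 0 < k) (n : ℤ) {v : Tens Φ} (hv : v ∈ vacuum P) :
    modes (psiPlus P) n v ∈ vacuum P := by
  refine lTensor_mem_vacuum hk P (matched_le P fun q φ hφ => ?_) hv
  rw [Submodule.mem_comap, psiPlus_tmul_e]
  refine tmul_e_mem_matched P ?_
  rw [add_comm 1 q, Int.cast_add, Int.cast_one]
  exact P.A_charge _ _ _ hφ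

theorem modes_psiMinus_mem_vacuum (hk : 0 < k) (n : ℤ) {v : Tens Φ} (hv : v ∈ vacuum P) :
    modes (psiMinus P) n v ∈ vacuum P := by
  refine lTensor_mem_vacuum hk P (matched_le P fun q φ hφ => ?_) hv
  rw [Submodule.mem_comap, psiMinus_tmul_e]
  refine tmul_e_mem_matched P ?_
  rw [neg_add_eq_sub, Int.cast_sub, Int.cast_one]
  exact P.A'_charge _ _ _ hφ

/-- Only the lattice factor matters: `e^{Mα}` raises the charge by `M`, and `H(0)` reads off twice
the charge. -/
theorem H_zero_modes {F : Field Φ} {M : ℤ} {s : ℚ} (hk : 0 < k) (n : ℤ) {v : Tens Φ}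
    (hv : v ∈ vacuum P) :
    H k Φ 0 (modes (prod (onFirst F) (lattice Φ M s)) n v) -
      modes (prod (onFirst F) (lattice Φ M s)) n (H k Φ 0 v) =
    (2 * (M : ℂ)) • modes (prod (onFirst F) (lattice Φ M s)) n v := by
  let T := modes (prod (onFirst F) (lattice Φ M s)) n
  refine vacuum_le hk P (S := LinearMap.eqLocus
    (H k Φ 0 ∘ₗ T - T ∘ₗ H k Φ 0) ((2 * (M : ℂ)) • T)) (fun q φ _ => ?_) hv
  simp only [LinearMap.mem_eqLocus, LinearMap.sub_apply, LinearMap.comp_apply,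
    LinearMap.smul_apply, H_zero_vac, map_smul, T, modes_vac]
  push_cast
  module

theorem genComm_psiPlus (hk : 0 < k) (m n : ℤ) {v : Tens Φ} (hv : v ∈ vacuum P) :
    genComm ((-2 / k : ℚ) : ℂ) (modes (psiPlus P)) (modes (psiPlus P)) m n v = 0 := by
  have ht := modes_truncated (truncated_psiPlus P)
  refine vacuum_le hk P (S := LinearMap.ker (genCommHom ((-2 / k : ℚ) : ℂ) ht ht m n))
    (fun q φ _ => ?_) hv
  refine (genComm_modes_vac P.A_truncated P.A_truncated ?_ ?_ m n q φ).trans ?_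
  · push_cast; ring
  · push_cast; ring
  · rw [P.A_A, sub_self, map_zero]

theorem genComm_psiMinus (hk : 0 < k) (m n : ℤ) {v : Tens Φ} (hv : v ∈ vacuum P) :
    genComm ((-2 / k : ℚ) : ℂ) (modes (psiMinus P)) (modes (psiMinus P)) m n v = 0 := by
  have ht := modes_truncated (truncated_psiMinus P)
  refine vacuum_le hk P (S := LinearMap.ker (genCommHom ((-2 / k : ℚ) : ℂ) ht ht m n))
    (fun q φ _ => ?_) hv
  refine (genComm_modes_vac P.A'_truncated P.A'_truncated ?_ ?_ m n q φ).trans ?_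
  · push_cast; ring
  · push_cast; ring
  · rw [P.A'_A', sub_self, map_zero]

/-- The commutator of the two parafermion fields on a vector of charge `qα`. -/
theorem ope_A_A'_sub_ope_A'_A {m n q : ℤ} {φ : Φ} (hφ : φ ∈ P.charge (q : ZMod k)) :
    ope (2 / k) P.A P.A' φ (-m + 2 * q / k) (-n - 2 * q / k) -
      ope (2 / k) P.A' P.A φ (-n - 2 * q / k) (-m + 2 * q / k) =
    if m + n = 0 then (((-m + 2 * q / k : ℚ) : ℂ) * k) • φ else 0 := by
  rw [ope_sub_ope P.A_truncated P.A'_truncated (P.A_A'_local φ) (P.A_A'_singular φ)]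
  · have : (-m + 2 * q / k + (-n - 2 * q / k) : ℚ) = 0 ↔ m + n = 0 := by
      rw [show (-m + 2 * q / k + (-n - 2 * q / k) : ℚ) = -((m + n : ℤ) : ℚ) by push_cast; ring,
        neg_eq_zero, Int.cast_eq_zero]
    simp only [this]
  · intro x hx
    -- A nonzero coefficient forces some mode of `A'` to act nontrivially on charge `q`. This fixes
    -- the power of `w`, hence that of `z`, modulo `ℤ`.
    obtain ⟨j, hj⟩ := ope_ne_zero hx
    obtain ⟨p, hp⟩ := P.A'_exponent q _ φ hφ hj
    refine ⟨2 - n - j - p, ?_⟩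
    push_cast
    linarith

theorem genComm_psiPlus_psiMinus (hk : 0 < k) (m n : ℤ) {v : Tens Φ} (hv : v ∈ vacuum P) :
    genComm ((2 / k : ℚ) : ℂ) (modes (psiPlus P)) (modes (psiMinus P)) m n v =
      delta m n • H k Φ 0 v + (-(k : ℂ) * wdwDelta m n) • v := by
  refine vacuum_le hk P (S := LinearMap.eqLocus
    (genCommHom ((2 / k : ℚ) : ℂ) (modes_truncated (truncated_psiPlus P))
      (modes_truncated (truncated_psiMinus P)) m n)
    (delta m n • H k Φ 0 + (-(k : ℂ) * wdwDelta m n) • LinearMap.id)) (fun q φ hφ => ?_) hv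
  refine (genComm_modes_vac P.A_truncated P.A'_truncated ?_ ?_ m n q φ).trans ?_
  · push_cast; ring
  · push_cast; ring
  · have e1 : (-m - 2 * (-1 / k) * q : ℚ) = -m + 2 * q / k := by ring
    have e2 : (-n - 2 * (1 / k) * q : ℚ) = -n - 2 * q / k := by ring
    rw [e1, e2, ope_A_A'_sub_ope_A'_A P hφ, add_neg_cancel_left]
    simp only [LinearMap.add_apply, LinearMap.smul_apply, H_zero_vac, LinearMap.id_apply,
      wdwDelta, delta]
    split_ifs with h
    -- With `m = -n` the scalar `(-m + 2q/k) k` is `2q + kn`: the eigenvalue of `H(0)` plus the `w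
    -- ∂_w δ` term at level `-k`.
    · have hm : (m : ℂ) = -n := by exact_mod_cast eq_neg_of_add_eq_zero_left h
      have hk' : (k : ℂ) ≠ 0 := by exact_mod_cast hk.ne'
      rw [map_smul, smul_smul, ← add_smul]
      congr 1
      push_cast
      rw [hm]
      field_simp
      ring
    · simp

/-- The representation of the `Z`-algebra at level `-k` on the vacuum space. -/
def zRep (hk : 0 < k) : ZRep (-(k : ℂ)) (vacuum P) where
  H0 := (H k Φ 0).restrict fun _ => H_zero_mem_vacuum hk P
  plus n := (modes (psiPlus P) n).restrict fun _ => modes_psiPlus_mem_vacuum P hk n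
  minus n := (modes (psiMinus P) n).restrict fun _ => modes_psiMinus_mem_vacuum P hk n
  plus_truncated x := by
    obtain ⟨N, hN⟩ := modes_truncated (truncated_psiPlus P) x.1
    exact ⟨N, fun n hn => Subtype.ext (hN n hn)⟩
  minus_truncated x := by
    obtain ⟨N, hN⟩ := modes_truncated (truncated_psiMinus P) x.1
    exact ⟨N, fun n hn => Subtype.ext (hN n hn)⟩
  H0_plus n x := Subtype.ext <| (H_zero_modes P hk n x.2).trans <| by
    rw [Int.cast_one, mul_one]
    rfl
  H0_minus n x := Subtype.ext <| (H_zero_modes P hk n x.2).trans <| by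
    rw [Int.cast_neg, Int.cast_one, mul_neg_one]
    rfl
  plus_plus m n x := by
    have hc : (2 / -(k : ℂ)) = ((-2 / k : ℚ) : ℂ) := by push_cast; ring
    rw [hc]
    exact Subtype.ext ((coe_genComm (fun _ _ => LinearMap.coe_restrict_apply _ _)
      (fun _ _ => LinearMap.coe_restrict_apply _ _) _ m n x).trans
      (genComm_psiPlus P hk m n x.2))
  minus_minus m n x := by
    have hc : (2 / -(k : ℂ)) = ((-2 / k : ℚ) : ℂ) := by push_cast; ring
    rw [hc]
    exact Subtype.ext ((coe_genComm (fun _ _ => LinearMap.coe_restrict_apply _ _)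
      (fun _ _ => LinearMap.coe_restrict_apply _ _) _ m n x).trans
      (genComm_psiMinus P hk m n x.2))
  plus_minus m n x := by
    have hc : (-2 / -(k : ℂ)) = ((2 / k : ℚ) : ℂ) := by push_cast; ring
    rw [hc]
    exact Subtype.ext ((coe_genComm (fun _ _ => LinearMap.coe_restrict_apply _ _)
      (fun _ _ => LinearMap.coe_restrict_apply _ _) _ m n x).trans
      (genComm_psiPlus_psiMinus P hk m n x.2))

end Representation

end Zalg

end

theorem theorem3p5 {k : ℕ} (hk : 0 < k) {Φ : Type*} [AddCommGroup Φ] [Module ℂ Φ]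
    (P : Zalg.Parafermion k Φ) :
    -- the operators `Z^±(z)` are well defined
    Zalg.AllDefined P ∧
    -- `Ω(V) = 1 ⊗ Φ ⊗ ℂ(ℤα)` (with matching charges)
    (∀ v : Zalg.Tens Φ, v ∈ Zalg.vacuum P ↔
      ∃ u ∈ Zalg.matched P, v = (1 : Zalg.Fock) ⊗ₜ[ℂ] u) ∧
    -- on `Ω(V)`, `Z^±(z)` acts as `A_{±α}(z) e^{±α} z^{∓α/k}`, with integral powers of `z`
    (∀ (r : ℚ), ∀ u ∈ Zalg.matched P,
      Zalg.Zplus P r ((1 : Zalg.Fock) ⊗ₜ[ℂ] u) = (1 : Zalg.Fock) ⊗ₜ[ℂ] Zalg.psiPlus P r u ∧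
      Zalg.Zminus P r ((1 : Zalg.Fock) ⊗ₜ[ℂ] u) = (1 : Zalg.Fock) ⊗ₜ[ℂ] Zalg.psiMinus P r u ∧
      ((∀ m : ℤ, r ≠ m) → Zalg.psiPlus P r u = 0 ∧ Zalg.psiMinus P r u = 0)) ∧
    -- this is a representation of the `Z`-algebra at level `-k` on `Ω(V)`
    ∃ ρ : Zalg.ZRep (-(k : ℂ)) (Zalg.vacuum P),
      ∀ ω : Zalg.vacuum P,
        (ρ.H0 ω : Zalg.Tens Φ) = Zalg.H k Φ 0 ω ∧
        ∀ n : ℤ,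
          (ρ.plus n ω : Zalg.Tens Φ) = Zalg.lift (Zalg.psiPlus P) (-n : ℚ) ω ∧
          (ρ.minus n ω : Zalg.Tens Φ) = Zalg.lift (Zalg.psiMinus P) (-n : ℚ) ω := by
  refine ⟨Zalg.allDefined P, Zalg.mem_vacuum_iff hk P, fun r u hu =>
    ⟨Zalg.Zplus_one_tmul P r u, Zalg.Zminus_one_tmul P r u, fun hr =>
      ⟨Zalg.psiPlus_eq_zero P hr hu, Zalg.psiMinus_eq_zero P hr hu⟩⟩, Zalg.zRep P hk, fun ω =>
    ⟨rfl, fun n => ⟨rfl, rfl⟩⟩⟩
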